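/- **Conventions.** For a set $C$ of ordinals, $\mathrm{acc}(C)=\{\alpha\in C\mid \sup(C\cap\alpha)=\alpha>0\}$ and $\mathrm{nacc}(C)=C\setminus\mathrm{acc}(C)$; $E^\kappa_\lambda=\{\alpha<\kappa\mid \mathrm{cf}(\alpha)=\lambda\}$. A $C$-sequence over $\kappa$ is a sequence $\langle C_\alpha\mid\alpha<\kappa\rangle$ such that each $C_\alpha$ is a closed subset of $\alpha$ with $\sup(C_\alpha)=\sup(\alpha)$. Write $D\sqsubseteq C$ iff $D=C\cap\beta$ for some ordinal $\beta$, and $D\sqsubseteq_\lambda C$ iff $D\sqsubseteq C$ or ($\mathrm{otp}(C)<\lambda$ and $\mathrm{nacc}(C)$ consists only of successor ordinals). A $C$-sequence is $\sqsubseteq_\lambda$-coherent iff $C_\beta\sqsubseteq_\lambda C_\alpha$ for all $\alpha<\kappa$ and $\beta\in\mathrm{acc}(C_\alpha)$. * $\square^B_\lambda$ asserts that there is a $\sqsubseteq_\lambda$-coherent $C$-sequence over $\lambda^+$ with $\mathrm{otp}(C_\alpha)\le\lambda$ for all $\alpha<\lambda^+$. * $\diamondsuit(\lambda)$ asserts that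 there is a sequence $\langle f_\beta\mid\beta<\lambda\rangle$ such that $\{\beta<\lambda\mid f\restriction\beta=f_\beta\}$ is stationary in $\lambda$ for every $f:\lambda\to\lambda$. * $\mathrm{P}^-(\kappa,2,\sqsubseteq_\lambda,\kappa,\{E^\kappa_\lambda\})$ asserts that there is a $\sqsubseteq_\lambda$-coherent $C$-sequence $\langle C_\alpha\mid\alpha<\kappa\rangle$ such that for every sequence $\langle B_i\mid i<\kappa\rangle$ of cofinal subsets of $\kappa$ there are stationarily many $\alpha\in E^\kappa_\lambda$ with $\sup(\mathrm{nacc}(C_\alpha)\cap B_i)=\alpha$ for all $i<\alpha$. A $\kappa$-tree is a poset $(T,<_T)$ in which the predecessors of every node are well-ordered, the level $T_\alpha$ (the nodes whose set of predecessors has order type $\alpha$) is nonempty and of size $<\kappa$ for every $\alpha<\kappa$, and $T_\kappa=\emptyset$. An $\alpha$-branch is a chain whose set of heights is $\alpha$; it is vanishing iff it has no upper bound in $T$. The tree is *full* iff for each limit $\alpha<\kappa$ it has at most one vanishing $\alpha$-branch; *normal* iff for all $\bar\alpha<\alpha<\kappa$ every $x\in T_{\bar\alpha}$ lies below some $y\in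 T_\alpha$; *splitting* iff every node has at least two immediate successors; *$\kappa$-Souslin* iff it has no $\kappa$-branch and no antichain of size $\kappa$. A *streamlined binary* $\kappa$-tree is a set $T\subseteq{}^{<\kappa}2$, ordered by inclusion, that is closed under initial segments and satisfies $0<|T\cap{}^\alpha2|<\kappa$ for all $\alpha<\kappa$. The product $\bigotimes_{i\in I}T^i$ of $\kappa$-trees has underlying set $\bigcup_{\alpha<\kappa}\prod_{i\in I}(T^i)_\alpha$ and order $\vec s<\vec t$ iff $\vec s(i)<_{T^i}\vec t(i)$ for all $i\in I$. **Theorem.** Let $\lambda$ be a regular uncountable cardinal and suppose that $\kappa=\lambda^+=2^\lambda$. Suppose that $\square^B_\lambda$, $\diamondsuit(\lambda)$ and $\mathrm{P}^-(\kappa,2,\sqsubseteq_\lambda,\kappa,\{E^\kappa_\lambda\})$ all hold. Then there is a family $\mathcal T$ of exactly $2^\kappa$ many pairwise distinct streamlined, normal, binary, splitting, full $\kappa$-trees such that for every nonempty $\mathcal T'\subseteq\mathcal T$ with $|\mathcal T'|<\lambda$, the product $\bigotimes\mathcal T'$ is a $\kappa$-Souslin tree (in particular a $\kappa$-tree). 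-/

import Mathlib

universe u v w

open Set Cardinal

namespace FullTrees

/-! ### Sets of ordinals -/

/-- `S ∩ κ` is stationary in the ordinal `κ`. -/
def StationaryIn (κ : Ordinal.{u}) (S : Set Ordinal.{u}) : Prop :=
  IsStationary {β : Iio κ | (β : Ordinal.{u}) ∈ S}

/-- `acc C`: the points `α ∈ C` with `sup (C ∩ α) = α > 0`. -/
def acc (C : Set Ordinal.{u}) : Set Ordinal.{u} :=
  {α ∈ C | sSup (C ∩ Iio α) = α ∧ 0 < α}

/-- `nacc C = C \ acc C`. -/
def nacc (C : Set Ordinal.{u}) : Set Ordinal.{u} :=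
  C \ acc C

/-- The order type of a set of ordinals (it lives one universe higher). -/
noncomputable def otp (C : Set Ordinal.{u}) : Ordinal.{u + 1} :=
  Ordinal.type (fun a b : C => a < b)

/-- `E^κ_lam`, the set of ordinals below `κ` of cofinality `lam`. -/
def E (κ lam : Cardinal.{u}) : Set Ordinal.{u} :=
  {α | α < κ.ord ∧ α.cof = lam}

/-! ### C-sequences, squares, the proxy principle, diamond -/

/-- `C` is a `C`-sequence over `κ`: for every `α < κ`, `C α` is a closed subset of `α`
with `sup (C α) = sup α`. -/
def IsCSequence (κ : Cardinal.{u}) (C : Ordinal.{u} → Set Ordinal.{u}) : Prop :=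
  ∀ α < κ.ord, C α ⊆ Iio α ∧
    (∀ β < α, 0 < β → sSup (C α ∩ Iio β) = β → β ∈ C α) ∧
    sSup (C α) = sSup (Iio α)

/-- `R`-coherence of a `C`-sequence over `κ`. -/
def IsCoherent (κ : Cardinal.{u}) (R : Set Ordinal.{u} → Set Ordinal.{u} → Prop)
    (C : Ordinal.{u} → Set Ordinal.{u}) : Prop :=
  ∀ α < κ.ord, ∀ β ∈ acc (C α), R (C β) (C α)

/-- `D ⊑ C`: `D = C ∩ β` for some ordinal `β`. -/
def InitialSeg (D C : Set Ordinal.{u}) : Prop :=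
  ∃ β : Ordinal.{u}, D = C ∩ Iio β

/-- `D ⊑_lam C`: `D ⊑ C`, or `otp C < lam` and `nacc C` consists only of successor ordinals. -/
def InitialSegMod (lam : Cardinal.{u}) (D C : Set Ordinal.{u}) : Prop :=
  InitialSeg D C ∨
    (otp C < Ordinal.lift.{u + 1} lam.ord ∧ ∀ β ∈ nacc C, ∃ γ, β = Order.succ γ)

/-- Baumgartner's square `□^B_lam`. -/
def BaumgartnerSquare (lam : Cardinal.{u}) : Prop :=
  ∃ C : Ordinal.{u} → Set Ordinal.{u},
    IsCSequence (Order.succ lam) C ∧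
    IsCoherent (Order.succ lam) (InitialSegMod lam) C ∧
    ∀ α < (Order.succ lam).ord, otp (C α) ≤ Ordinal.lift.{u + 1} lam.ord

/-- The proxy principle `P⁻(κ, 2, R, θ, 𝒮)`. -/
def ProxyMinus (κ : Cardinal.{u}) (R : Set Ordinal.{u} → Set Ordinal.{u} → Prop)
    (θ : Cardinal.{u}) (𝒮 : Set (Set Ordinal.{u})) : Prop :=
  ∃ C : Ordinal.{u} → Set Ordinal.{u},
    IsCSequence κ C ∧ IsCoherent κ R C ∧
    ∀ B : Ordinal.{u} → Set Ordinal.{u},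
      (∀ i < θ.ord, B i ⊆ Iio κ.ord ∧ ∀ γ < κ.ord, ∃ β ∈ B i, γ ≤ β) →
      ∀ S ∈ 𝒮, StationaryIn κ.ord
        {α ∈ S | ∀ i < min α θ.ord, sSup (nacc (C α) ∩ B i) = α}

/-- Jensen's diamond `◇(κ)`: some sequence `⟨f β | β < κ⟩` guesses every function from `κ` to `κ`
on a stationary set. Only the restriction of `f β` to `β` matters. -/
def Diamond (κ : Cardinal.{u}) : Prop :=
  ∃ f : Ordinal.{u} → Ordinal.{u} → Ordinal.{u},
    ∀ g : Ordinal.{u} → Ordinal.{u}, (∀ γ < κ.ord, g γ < κ.ord) →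
      StationaryIn κ.ord {β | ∀ γ < β, g γ = f β γ}

/-! ### Abstract trees -/

section Trees

variable (κ : Cardinal.{u}) (T : Type v) [PartialOrder T]

/-- The level `T_α`: the nodes `x` whose set of predecessors has order type `α`. -/
def level (α : Ordinal.{u}) : Set T :=
  {x | Nonempty (Iio x ≃o Iio α)}

/-- `κ`-trees. -/
structure IsKTree : Prop where
  chain_Iio : ∀ x : T, IsChain (· ≤ ·) (Iio x)
  wf_Iio : ∀ x : T, (Iio x).IsWF
  level_nonempty : ∀ α < κ.ord, (level T α).Nonempty
  level_small : ∀ α < κ.ord, lift.{u} #(level T α) < lift.{v} κ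
  level_top : level T κ.ord = ∅

variable {T} in
/-- `B` is an `α`-branch: a chain whose set of heights is `α`. -/
def IsBranch (α : Ordinal.{u}) (B : Set T) : Prop :=
  IsChain (· ≤ ·) B ∧ (∀ x ∈ B, ∃ β < α, x ∈ level T β) ∧ ∀ β < α, ∃ x ∈ B, x ∈ level T β

variable {T} in
/-- `B` is vanishing: it has no upper bound in the tree. -/
def IsVanishing (B : Set T) : Prop :=
  ¬ ∃ y : T, ∀ x ∈ B, x ≤ y

/-- Fullness: at most one vanishing `α`-branch for each limit `α < κ`. -/
def IsFull : Prop :=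
  ∀ α < κ.ord, Order.IsSuccLimit α →
    {B : Set T | IsBranch α B ∧ IsVanishing B}.Subsingleton

/-- Normality: every node has extensions in all higher levels below `κ`. -/
def IsNormal : Prop :=
  ∀ α < κ.ord, ∀ β < α, ∀ x ∈ level T β, ∃ y ∈ level T α, x < y

/-- Splitting: every node has at least two immediate successors. -/
def IsSplitting : Prop :=
  ∀ x : T, ∃ y z : T, y ≠ z ∧ x ⋖ y ∧ x ⋖ z

/-- `κ`-Souslin trees. -/
structure IsSouslin : Prop where
  isKTree : IsKTree κ T
  no_branch : ¬ ∃ B : Set T, IsBranch κ.ord B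
  no_antichain : ¬ ∃ A : Set T, IsAntichain (· ≤ ·) A ∧ lift.{u} #A = lift.{v} κ

end Trees

/-! ### Products of trees -/

/-- The underlying set of the product of a family of `κ`-trees: the union over `α < κ` of the
products of the `α`-th levels. -/
def Prod (κ : Cardinal.{u}) {ι : Type w} (T : ι → Type v) [∀ i, PartialOrder (T i)] :=
  {s : ∀ i, T i // ∃ α < κ.ord, ∀ i, s i ∈ level (T i) α}

/-- The order of the product: `s < t` iff `s i < t i` for all `i`. -/
instance (κ : Cardinal.{u}) {ι : Type w} (T : ι → Type v) [∀ i, PartialOrder (T i)] :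
    PartialOrder (Prod κ T) where
  le s t := s = t ∨ ∀ i, s.1 i < t.1 i
  le_refl s := Or.inl rfl
  le_trans s t r := by
    rintro (rfl | h) (rfl | h')
    · exact Or.inl rfl
    · exact Or.inr h'
    · exact Or.inr h
    · exact Or.inr fun i => (h i).trans (h' i)
  le_antisymm s t := by
    rintro (rfl | h) (h' | h')
    · rfl
    · rfl
    · exact h'.symm
    · exact Subtype.ext (funext fun i => absurd (h i) (h' i).asymm)

/-- For a nonempty family, the strict order of the product is the coordinatewise strict order. -/
theorem Prod.lt_iff (κ : Cardinal.{u}) {ι : Type w} [Nonempty ι] (T : ι → Type v)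
    [∀ i, PartialOrder (T i)] (s t : Prod κ T) : s < t ↔ ∀ i, s.1 i < t.1 i := by
  constructor
  · intro h
    rcases h.le with h' | h'
    · exact absurd h' h.ne
    · exact h'
  · intro h
    refine lt_of_le_of_ne (Or.inr h) ?_
    rintro rfl
    exact lt_irrefl _ (h (Classical.arbitrary ι))

/-! ### Binary sequences and streamlined binary trees -/

/-- A transfinite binary sequence, that is, a function from an ordinal `len` to `2 = {0, 1}`. -/
structure BinSeq : Type (u + 1) where
  len : Ordinal.{u}
  val : Iio len → Bool

/-- Binary sequences are ordered by inclusion: `s ≤ t` iff `t` extends `s`. -/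
instance : PartialOrder BinSeq.{u} where
  le s t := ∃ h : s.len ≤ t.len, ∀ i : Iio s.len, t.val ⟨i.1, i.2.trans_le h⟩ = s.val i
  le_refl s := ⟨le_rfl, fun _ => rfl⟩
  le_trans s t r := by
    rintro ⟨h, hv⟩ ⟨h', hv'⟩
    exact ⟨h.trans h', fun i => (hv' ⟨i.1, i.2.trans_le h⟩).trans (hv i)⟩
  le_antisymm s t := by
    rintro ⟨h, hv⟩ ⟨h', -⟩
    obtain ⟨a, f⟩ := s
    obtain ⟨b, g⟩ := t
    obtain rfl : a = b := le_antisymm h h'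
    congr 1
    exact funext fun i => (hv i).symm

/-- A streamlined binary `κ`-tree: a set of binary sequences of length below `κ`, closed under
initial segments, such that for each `α < κ` the number of members of length `α` is nonzero and
less than `κ`. It is regarded as a tree under inclusion. -/
structure IsStreamlinedBinary (κ : Cardinal.{u}) (T : Set BinSeq.{u}) : Prop where
  len_lt : ∀ t ∈ T, t.len < κ.ord
  downward_closed : ∀ t ∈ T, ∀ s ≤ t, s ∈ T
  nonempty : ∀ α < κ.ord, {t ∈ T | t.len = α}.Nonempty
  small : ∀ α < κ.ord, #{t ∈ T | t.len = α} < lift.{u + 1} κ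

end FullTrees

open FullTrees

namespace FullTrees

/-! ### Closure points, limit points and cofinality -/

/-! Write `κ = λ⁺`. For each `η : κ → 2` a tree is defined by deciding recursively which binary
sequences are nodes (`Good`). A branch through nodes is discarded only at limits `α` of cofinality
below `λ`, and only if its coded restrictions along `D α` are those listed by `F α` and it is not
canonical, that is, it is not a walk along `C α` (`path`) started from one of its own restrictions.
The list determines the branch, so at most one is lost per level: this is fullness (`kill_unique`).

These few removals suffice. `◇(λ)`, transported by Baumgartner's square to ladders of order type
`λ`, guesses every noncanonical branch of a level `α` of cofinality `λ` at some `δ < α` where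
coherence of `C` shows it to be noncanonical already. Hence all nodes on levels of cofinality `λ`
are canonical (`eq_path_of_good`). With `λ^{<λ} = λ`, a consequence of `◇(λ)`, levels have size at
most `λ` (`mk_lev_le`). For normality (`exists_good_extension`): where `C` is coherent a walk along
it is never removed; elsewhere the cofinality is below `λ`, and `λ` many walks along a short club
cannot all be removed, as each level removes only one.

Antichains are sealed inside the walks. In the step from `σ` to `γ` a walk moves, if it can, to a
node prescribed by `sealing`. This is computed from a guess `Ω γ`, available because `2^λ = λ⁺` and
`λ^ω = λ`, of a tuple of parameters, a tuple of starting nodes and an enumerated dense set of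
tuples. The prescription is made for all coordinates at once, and each tree reads off its own
coordinate with `η ↾ γ` as a label, so walks in different trees cooperate. The proxy principle gives
a level `α` of cofinality `λ` whose ladder meets, for each index `o < α` of a starting tuple,
nonlimit points at which the guess is right. As all nodes of length `α` are ends of walks, every
tuple of them extends a member of the dense set (`exists_sealed_level`). Suitable dense sets exclude
large antichains and cofinal branches of products; the dense set of pairs with distinct coordinates
shows that distinct `η` give distinct trees (`tree_ne`), hence `2^κ` many. -/

theorem exists_lt_of_mk_lt_cof {a : Ordinal.{u}} {S : Set Ordinal.{u}}
    (hS : #S < lift.{u + 1} a.cof) (h : ∀ x ∈ S, x < a) : ∃ b < a, ∀ x ∈ S, x < b := by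
  rw [Ordinal.lift_cof] at hS
  refine ⟨_, Ordinal.sSup_add_one_lt_of_lt_cof hS h, fun x hx => ?_⟩
  refine (lt_add_one x).trans_le (le_csSup ?_ ⟨x, hx, rfl⟩)
  refine ⟨a, ?_⟩
  rintro _ ⟨y, hy, rfl⟩
  exact Order.add_one_le_of_lt (h y hy)

theorem exists_lt_of_family {a : Ordinal.{u}} {ι : Type (u + 1)} (f : ι → Ordinal.{u})
    (hι : #ι < lift.{u + 1} a.cof) (h : ∀ i, f i < a) : ∃ b < a, ∀ i, f i < b := by
  obtain ⟨b, hb, hb'⟩ := exists_lt_of_mk_lt_cof (S := range f) (a := a)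
    (mk_range_le.trans_lt hι) (by rintro _ ⟨i, rfl⟩; exact h i)
  exact ⟨b, hb, fun i => hb' _ ⟨i, rfl⟩⟩

theorem mk_Iio_lt_of_lt_ord {κ : Cardinal.{u}} {c : Ordinal.{u}} (hc : c < κ.ord) :
    #(Iio c) < lift.{u + 1} κ := by
  rw [mk_Iio_ordinal, lift_lt]
  exact lt_ord.1 hc

/-- Iterating `ω` times yields a closure point together with a cofinal `ω`-sequence. The sequence is
what lets guesses at such points be coded by countably many parameters. -/
theorem exists_closure_point_seq {κ : Cardinal.{u}} (hκ : κ.IsRegular) (hκ' : ℵ₀ < κ)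
    (d : Ordinal.{u} → Ordinal.{u}) (hd : ∀ γ < κ.ord, d γ < κ.ord) {c : Ordinal.{u}}
    (hc : c < κ.ord) : ∃ β < κ.ord, c < β ∧ (∀ γ < β, d γ < β) ∧
      ∃ s : ℕ → Ordinal.{u}, (∀ n, s n < β) ∧ ∀ γ < β, ∃ n, γ < s n := by
  have key : ∀ c : Ordinal.{u}, ∃ b, c < κ.ord → b < κ.ord ∧ c < b ∧ ∀ γ ≤ c, d γ < b := by
    intro c
    by_cases hc : c < κ.ord
    · have hc' : Order.succ c < κ.ord := (isSuccLimit_ord hκ.aleph0_le).succ_lt hc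
      obtain ⟨b, hb, hb'⟩ := exists_lt_of_family (a := κ.ord)
        (fun x : Iio (Order.succ c) => max x.1 (d x.1))
        (by rw [hκ.cof_ord]; exact mk_Iio_lt_of_lt_ord hc')
        (fun x => max_lt (x.2.trans hc') (hd _ (x.2.trans hc')))
      refine ⟨b, fun _ => ⟨hb, ?_, fun γ hγ => ?_⟩⟩
      · exact (le_max_left _ _).trans_lt (hb' ⟨c, Order.lt_succ c⟩)
      · exact (le_max_right _ _).trans_lt (hb' ⟨γ, Order.lt_succ_iff.2 hγ⟩)
    · exact ⟨0, fun h => absurd h hc⟩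
  choose g hg using key
  have hn : Ordinal.nfp g c < κ.ord :=
    nfp_lt_ord_of_isRegular hκ hκ'.ne' (fun i hi => (hg i hi).1) hc
  refine ⟨_, hn, ?_, fun γ hγ => ?_, fun n => g^[n] c, fun n => ?_, fun γ hγ => Ordinal.lt_nfp_iff.1 hγ⟩
  · exact (hg c hc).2.1.trans_le (by simpa using Ordinal.iterate_le_nfp g c 1)
  · obtain ⟨n, hn'⟩ := Ordinal.lt_nfp_iff.1 hγ
    have h1 := (hg _ ((Ordinal.iterate_le_nfp g c n).trans_lt hn)).2.2 γ hn'.le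
    refine h1.trans_le ?_
    have := Ordinal.iterate_le_nfp g c (n + 1)
    rwa [Function.iterate_succ_apply'] at this
  · have := Ordinal.iterate_le_nfp g c (n + 1)
    rw [Function.iterate_succ_apply'] at this
    exact (hg _ ((Ordinal.iterate_le_nfp g c n).trans_lt hn)).2.1.trans_le this

theorem exists_closure_point {κ : Cardinal.{u}} (hκ : κ.IsRegular) (hκ' : ℵ₀ < κ)
    (d : Ordinal.{u} → Ordinal.{u}) (hd : ∀ γ < κ.ord, d γ < κ.ord) {c : Ordinal.{u}}
    (hc : c < κ.ord) : ∃ β < κ.ord, c < β ∧ ∀ γ < β, d γ < β :=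
  let ⟨β, h1, h2, h3, _⟩ := exists_closure_point_seq hκ hκ' d hd hc
  ⟨β, h1, h2, h3⟩

theorem isClub_closure_points {κ : Cardinal.{u}} (hκ : κ.IsRegular) (hκ' : ℵ₀ < κ)
    (d : Ordinal.{u} → Ordinal.{u}) (hd : ∀ γ < κ.ord, d γ < κ.ord) :
    IsClub {β : Iio κ.ord | 0 < β.1 ∧ ∀ γ < β.1, d γ < β.1} := by
  refine ⟨fun s hs hs0 _ a ha => ⟨?_, fun γ hγ => ?_⟩, fun c => ?_⟩
  · obtain ⟨x, hx⟩ := hs0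
    exact (hs hx).1.trans_le (ha.1 hx)
  · have : (⟨γ, hγ.trans a.2⟩ : Iio κ.ord) < a := hγ
    obtain ⟨x, hx, hx'⟩ := (lt_isLUB_iff ha).1 this
    exact ((hs hx).2 γ hx').trans_le (ha.1 hx)
  · obtain ⟨β, h1, h2, h3⟩ := exists_closure_point hκ hκ' d hd c.2
    exact ⟨⟨β, h1⟩, ⟨h2.bot_lt, h3⟩, h2.le⟩

theorem StationaryIn.exists_closure_point {κ : Cardinal.{u}} (hκ : κ.IsRegular) (hκ' : ℵ₀ < κ)
    {S : Set Ordinal.{u}} (hS : StationaryIn κ.ord S)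
    (d : Ordinal.{u} → Ordinal.{u}) (hd : ∀ γ < κ.ord, d γ < κ.ord) :
    ∃ β ∈ S, 0 < β ∧ β < κ.ord ∧ ∀ γ < β, d γ < β := by
  obtain ⟨β, h1, h2⟩ := hS (isClub_closure_points hκ hκ' d hd)
  exact ⟨β, h1, h2.1, β.2, h2.2⟩

/-- `δ` is a positive limit of points of `C`. -/
def LimPt (C : Set Ordinal.{u}) (δ : Ordinal.{u}) : Prop :=
  0 < δ ∧ ∀ γ < δ, ∃ β ∈ C, γ < β ∧ β < δ

theorem LimPt.isSuccLimit {C : Set Ordinal.{u}} {δ : Ordinal.{u}} (h : LimPt C δ) :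
    Order.IsSuccLimit δ := by
  refine ⟨fun h0 => h.1.ne (h0.eq_bot).symm, fun γ hγ => ?_⟩
  obtain ⟨β, -, h1, h2⟩ := h.2 γ hγ.lt
  exact hγ.2 h1 h2

theorem limPt_iff_sSup {C : Set Ordinal.{u}} {δ : Ordinal.{u}} :
    LimPt C δ ↔ sSup (C ∩ Iio δ) = δ ∧ 0 < δ := by
  have hb : BddAbove (C ∩ Iio δ) := ⟨δ, fun x hx => hx.2.le⟩
  constructor
  · intro h
    refine ⟨le_antisymm (csSup_le' fun x hx => hx.2.le) ?_, h.1⟩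
    by_contra! hlt
    obtain ⟨β, h1, h2, h3⟩ := h.2 _ hlt
    exact h2.not_ge (le_csSup hb ⟨h1, h3⟩)
  · rintro ⟨h, h0⟩
    refine ⟨h0, fun γ hγ => ?_⟩
    rw [← h] at hγ
    obtain ⟨β, hβ, hγβ⟩ := exists_lt_of_lt_csSup' hγ
    exact ⟨β, hβ.1, hγβ, hβ.2⟩

theorem mem_acc_iff {C : Set Ordinal.{u}} {δ : Ordinal.{u}} : δ ∈ acc C ↔ δ ∈ C ∧ LimPt C δ := by
  rw [limPt_iff_sSup]; rfl

theorem isSuccLimit_of_cof_eq {lam : Cardinal.{u}} (hlam : ℵ₀ < lam) {α : Ordinal.{u}}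
    (h : α.cof = lam) : Order.IsSuccLimit α := by
  rw [← Ordinal.one_lt_cof_iff, h]
  exact one_lt_aleph0.trans hlam

/-- `C` is a club subset of `α`. -/
structure IsClubIn (α : Ordinal.{u}) (C : Set Ordinal.{u}) : Prop where
  subset : C ⊆ Iio α
  limPt : LimPt C α
  closed : ∀ δ < α, LimPt C δ → δ ∈ C

theorem IsClubIn.exists_ge {α : Ordinal.{u}} {C : Set Ordinal.{u}} (h : IsClubIn α C)
    {γ : Ordinal.{u}} (hγ : γ < α) : ∃ ε ∈ C, γ < ε ∧ ε < α :=
  h.limPt.2 γ hγ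

/-- Closing a cofinal set off under limits does not enlarge it: send a limit point to the least
element of the set not below it. Two limit points are separated by an element of the set, so this
map is strictly increasing. -/
theorem exists_isClubIn {α : Ordinal.{u}} (hα : Order.IsSuccLimit α) :
    ∃ C, IsClubIn α C ∧ #C ≤ lift.{u + 1} α.cof := by
  obtain ⟨s, hs, hs'⟩ := Order.exists_cof_eq (Iio α)
  set S : Set Ordinal.{u} := Subtype.val '' s with hS
  have hScard : #S = lift.{u + 1} α.cof := by
    rw [hS, mk_image_eq Subtype.val_injective, hs', Ordinal.cof_Iio, Ordinal.lift_cof]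
  have hlim : ∀ γ < α, ∃ β ∈ S, γ < β ∧ β < α := by
    intro γ hγ
    obtain ⟨b, hb, hb'⟩ := hs ⟨_, hα.succ_lt hγ⟩
    exact ⟨b, ⟨b, hb, rfl⟩, (Order.lt_succ γ).trans_le hb', b.2⟩
  set L : Set Ordinal.{u} := {δ | δ < α ∧ LimPt S δ}
  have hL : #L ≤ #S := by
    have : ∀ δ : L, ∃ β : S, δ.1 ≤ β ∧ ∀ β' ∈ S, δ.1 ≤ β' → β.1 ≤ β' := by
      intro δ
      have hne : {β | β ∈ S ∧ δ.1 ≤ β}.Nonempty := by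
        obtain ⟨β, h1, h2, -⟩ := hlim _ δ.2.1
        exact ⟨β, h1, h2.le⟩
      have hm := csInf_mem hne
      exact ⟨⟨_, hm.1⟩, hm.2, fun β' h1 h2 => csInf_le' ⟨h1, h2⟩⟩
    choose g hg hg' using this
    have aux : ∀ a b : L, a < b → (g a).1 < (g b).1 := by
      intro a b hab
      obtain ⟨β, h1, h2, h3⟩ := b.2.2.2 _ hab
      exact ((hg' a β h1 h2.le).trans_lt h3).trans_le (hg b)
    refine mk_le_of_injective (f := g) fun a b hab => ?_
    by_contra hne
    rcases lt_or_gt_of_ne hne with h | h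
    · exact (aux _ _ h).ne (congrArg _ hab)
    · exact (aux _ _ h).ne' (congrArg _ hab)
  refine ⟨S ∪ L, ⟨?_, ⟨hα.bot_lt, fun γ hγ => ?_⟩, fun δ hδ h => Or.inr ⟨hδ, h.1, fun γ hγ => ?_⟩⟩, ?_⟩
  · rintro x (⟨y, -, rfl⟩ | hx)
    · exact y.2
    · exact hx.1
  · obtain ⟨β, h1, h2⟩ := hlim γ hγ
    exact ⟨β, Or.inl h1, h2⟩
  · obtain ⟨β, h1 | h1, h2, h3⟩ := h.2 γ hγ
    · exact ⟨β, h1, h2, h3⟩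
    · obtain ⟨β', h1', h2', h3'⟩ := h1.2.2 γ h2
      exact ⟨β', h1', h2', h3'.trans h3⟩
  · refine (mk_union_le _ _).trans ?_
    have h0 : ℵ₀ ≤ #S := by
      rw [hScard, aleph0_le_lift, Ordinal.aleph0_le_cof_iff, Ordinal.one_lt_cof_iff]
      exact hα
    rw [← hScard]
    exact (add_le_add_right hL _).trans (by rw [add_eq_self h0])

/-! ### Diamond and cardinal arithmetic -/

theorem exists_surjective_of_mk_le {α β : Type v} [Nonempty β] (h : #β ≤ #α) :
    ∃ q : α → β, Function.Surjective q :=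
  let ⟨e⟩ := (Cardinal.le_def _ _).1 h
  ⟨_, Function.invFun_surjective e.injective⟩

/-- Every function from `c` to `lam` is read off from some entry of the diamond sequence, and there
are only `lam` entries. -/
theorem Diamond.power_le {lam : Cardinal.{u}} (hreg : lam.IsRegular) (hunc : ℵ₀ < lam)
    (h : Diamond lam) {c : Cardinal.{u}} (hc : c < lam) : lam ^ c ≤ lam := by
  obtain ⟨f, hf⟩ := h
  have key : ∀ g : Iio c.ord → Iio lam.ord, ∃ β : Iio lam.ord,
      ∀ γ : Iio c.ord, (g γ).1 = f β γ := by
    intro g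
    let g' : Ordinal.{u} → Ordinal.{u} := fun γ => if hγ : γ < c.ord then (g ⟨γ, hγ⟩).1 else 0
    have hg' : ∀ γ < lam.ord, g' γ < lam.ord := by
      intro γ _
      by_cases hγ : γ < c.ord
      · simpa only [g', dif_pos hγ] using mem_Iio.1 (g ⟨γ, hγ⟩).2
      · simpa only [g', dif_neg hγ] using hreg.ord_pos
    -- Closure under the constant function `c.ord` forces `c.ord < β`.
    obtain ⟨β, h1, h2, h3, h4⟩ := (hf g' hg').exists_closure_point hreg hunc (fun _ => c.ord)
      (fun _ _ => ord_lt_ord.2 hc)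
    refine ⟨⟨β, h3⟩, fun γ => ?_⟩
    have := h1 γ (γ.2.trans (h4 0 h2))
    rwa [show g' γ = (g γ).1 from dif_pos γ.2] at this
  choose β hβ using key
  have := mk_le_of_injective (f := β) fun g g' hgg' => by
    funext γ
    exact Subtype.ext ((hβ g γ).trans ((congrArg (fun b => f b.1 γ) hgg').trans (hβ g' γ).symm))
  rwa [← power_def, mk_Iio_ordinal, mk_Iio_ordinal, card_ord, card_ord, ← lift_power,
    lift_le] at this

theorem exists_enumeration_of_initial_segments {lam : Cardinal.{u}} (hlam : ℵ₀ ≤ lam)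
    (hpow : Order.succ lam = 2 ^ lam) {W : Type (u + 1)} [Nonempty W]
    (hW : #W ≤ lift.{u + 1} (2 ^ lam)) :
    ∃ h : Ordinal.{u} → Ordinal.{u} → W, ∀ G : Ordinal.{u} → W, ∀ β < (Order.succ lam).ord,
      ∃ i < (Order.succ lam).ord, ∀ γ < β, G γ = h i γ := by
  let Fn := Σ β : Iio (Order.succ lam).ord, (Iio β.1 → W)
  have hFn : #Fn ≤ #(Iio (Order.succ lam).ord) := by
    rw [mk_sigma, mk_Iio_ordinal, card_ord]
    have : ∀ β : Iio (Order.succ lam).ord, #(Iio β.1 → W) ≤ lift.{u + 1} (Order.succ lam) := by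
      intro β
      have hβ : β.1.card ≤ lam := Order.lt_succ_iff.1 (lt_ord.1 β.2)
      rw [← power_def, mk_Iio_ordinal]
      calc #W ^ lift.{u + 1} β.1.card
          ≤ (lift.{u + 1} (2 ^ lam)) ^ lift.{u + 1} β.1.card := power_le_power_right hW
        _ ≤ (lift.{u + 1} (2 ^ lam)) ^ lift.{u + 1} lam := by
            apply power_le_power_left _ (lift_le.2 hβ)
            rw [← hpow, Ne, lift_eq_zero]
            exact (Order.bot_lt_succ lam).ne'
        _ = lift.{u + 1} (Order.succ lam) := by
            rw [← lift_power, ← power_mul, mul_eq_self hlam, ← hpow]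
    refine (sum_le_sum _ (fun _ => lift.{u + 1} (Order.succ lam)) this).trans ?_
    rw [sum_const', mk_Iio_ordinal, card_ord, mul_eq_self]
    rw [aleph0_le_lift]
    exact hlam.trans (Order.le_succ lam)
  have hpos : 0 < (Order.succ lam).ord := ord_pos.2 (Order.bot_lt_succ lam)
  have : Nonempty Fn := ⟨⟨⟨0, hpos⟩, fun _ => Classical.arbitrary W⟩⟩
  obtain ⟨q, hq⟩ := exists_surjective_of_mk_le hFn
  classical
  refine ⟨fun i γ => if hi : i ∈ Iio (Order.succ lam).ord then
    (if hγ : γ ∈ Iio (q ⟨i, hi⟩).1.1 then (q ⟨i, hi⟩).2 ⟨γ, hγ⟩ else Classical.arbitrary W)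
      else Classical.arbitrary W, fun G β hβ => ?_⟩
  obtain ⟨i, hi⟩ := hq ⟨⟨β, hβ⟩, fun γ => G γ⟩
  refine ⟨i, i.2, fun γ hγ => ?_⟩
  have h1 : (i : Ordinal.{u}) ∈ Iio (Order.succ lam).ord := i.2
  have h2 : γ ∈ Iio (q i).1.1 := by rw [hi]; exact hγ
  have h3 : (q i).2 ⟨γ, h2⟩ = G γ := by
    generalize q i = x at hi h2 ⊢
    subst hi
    rfl
  simp only [dif_pos h1, Subtype.coe_eta, dif_pos h2, h3]

/-- Gregory's argument at points of cofinality `ω`. A function on such a `β` is glued from countably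
many enumerated initial segments, so `λ^ω = λ` leaves only `λ` candidates at `β`. If for each `ξ <
λ` the sequence of `ξ`-th candidates failed, the counterexamples could be combined into one function
with values in `λ → V`, against the fact that one candidate is right. Since `d` is arbitrary,
guessing at one closure point amounts to guessing stationarily often. -/
theorem exists_diamond_succ {lam : Cardinal.{u}} (hlam : ℵ₀ ≤ lam)
    (hpow : Order.succ lam = 2 ^ lam) (hω : lam ^ ℵ₀ ≤ lam) {V : Type (u + 1)} [Nonempty V]
    (hV : #V ≤ lift.{u + 1} (2 ^ lam)) :
    ∃ Ω : Ordinal.{u} → Ordinal.{u} → V, ∀ G : Ordinal.{u} → V, ∀ d : Ordinal.{u} → Ordinal.{u},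
      (∀ γ < (Order.succ lam).ord, d γ < (Order.succ lam).ord) →
      ∃ β < (Order.succ lam).ord, 0 < β ∧ (∀ γ < β, d γ < β) ∧ ∀ γ < β, G γ = Ω β γ := by
  set κ := Order.succ lam with hκdef
  have hκ : κ.IsRegular := isRegular_succ hlam
  have hκ' : ℵ₀ < κ := Order.lt_succ_iff.2 hlam
  let L := Iio lam.ord
  have hL : #L = lift.{u + 1} lam := by rw [mk_Iio_ordinal, card_ord]
  let W := L → V
  have hW : #W ≤ lift.{u + 1} (2 ^ lam) := by
    rw [← power_def, hL]
    refine (power_le_power_right hV).trans ?_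
    rw [← lift_power, ← power_mul, mul_eq_self hlam]
  obtain ⟨h, hh⟩ := exists_enumeration_of_initial_segments hlam hpow hW
  have hsurj : ∀ δ : Ordinal.{u}, ∃ q : L → (ℕ → Ordinal.{u} × Ordinal.{u}), δ < κ.ord → 0 < δ →
      ∀ s : ℕ → Ordinal.{u} × Ordinal.{u}, (∀ n, (s n).1 < δ ∧ (s n).2 < δ) → ∃ ξ, q ξ = s := by
    intro δ
    by_cases hδ : δ < κ.ord ∧ 0 < δ
    · let X := ℕ → Iio δ × Iio δ
      have hX : #X ≤ #L := by
        have hδ' : δ.card ≤ lam := Order.lt_succ_iff.1 (lt_ord.1 hδ.1)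
        rw [hL, show #X = #(Iio δ × Iio δ) ^ lift.{u + 1} #ℕ by
          simp [X], mk_prod, lift_id, mk_nat, mk_Iio_ordinal, ← lift_mul, lift_aleph0,
          ← lift_aleph0.{u + 1, u}, ← lift_power, lift_le]
        refine le_trans (power_le_power_right ?_) hω
        exact (mul_le_mul' hδ' hδ').trans (mul_eq_self hlam).le
      have : Nonempty X := ⟨fun _ => (⟨0, hδ.2⟩, ⟨0, hδ.2⟩)⟩
      obtain ⟨q, hq⟩ := exists_surjective_of_mk_le hX
      refine ⟨fun ξ n => ((q ξ n).1.1, (q ξ n).2.1), fun _ _ s hs => ?_⟩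
      obtain ⟨ξ, hξ⟩ := hq fun n => (⟨(s n).1, (hs n).1⟩, ⟨(s n).2, (hs n).2⟩)
      exact ⟨ξ, by simp only [hξ]⟩
    · exact ⟨fun _ _ => (0, 0), fun h1 h2 => absurd ⟨h1, h2⟩ hδ⟩
  choose q hq using hsurj
  classical
  -- Candidate `ξ` at `δ` is a countable list of pairs (bound, index of an initial segment); the
  -- value at `γ` comes from the first segment whose bound exceeds `γ`.
  let w : Ordinal.{u} → L → Ordinal.{u} → W := fun δ ξ γ =>
    if hn : ∃ n, γ < (q δ ξ n).1 then h (q δ ξ (Nat.find hn)).2 γ else Classical.arbitrary W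
  have key : ∀ (G : Ordinal.{u} → W) (d : Ordinal.{u} → Ordinal.{u}),
      (∀ γ < κ.ord, d γ < κ.ord) → ∃ β < κ.ord, 0 < β ∧ (∀ γ < β, d γ < β) ∧
        ∃ ξ, ∀ γ < β, G γ = w β ξ γ := by
    intro G d hd
    have := fun β => if hβ : β < κ.ord then
      (hh G β hβ).imp fun i hi => (fun _ => hi : β < κ.ord → i < κ.ord ∧ ∀ γ < β, G γ = h i γ)
      else ⟨0, fun h => absurd h hβ⟩
    choose c hc using this
    obtain ⟨β, h1, h2, h3, s, hs, hs'⟩ := exists_closure_point_seq hκ hκ'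
      (fun γ => max (d γ) (c γ)) (fun γ hγ => max_lt (hd γ hγ) (hc γ hγ).1) hκ.ord_pos
    refine ⟨β, h1, h2, fun γ hγ => (le_max_left _ _).trans_lt (h3 γ hγ), ?_⟩
    obtain ⟨ξ, hξ⟩ := hq β h1 h2 (fun n => (s n, c (s n)))
      (fun n => ⟨hs n, (le_max_right _ _).trans_lt (h3 _ (hs n))⟩)
    refine ⟨ξ, fun γ hγ => ?_⟩
    have hex : ∃ n, γ < (q β ξ n).1 := by rw [hξ]; exact hs' γ hγ
    have hw : w β ξ γ = h (q β ξ (Nat.find hex)).2 γ := dif_pos hex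
    have h4 := Nat.find_spec hex
    rw [hw]
    generalize Nat.find hex = n at h4 ⊢
    rw [hξ] at h4 ⊢
    exact (hc (s n) ((hs n).trans h1)).2 γ h4
  have hLne : Nonempty L := ⟨⟨0, ord_pos.2 (aleph0_pos.trans_le hlam)⟩⟩
  by_contra! hcon
  choose G d hd hG using fun ξ : L => hcon fun δ γ => w δ ξ γ ξ
  have hsup : ∀ γ : Ordinal.{u}, ∃ b, γ < κ.ord → b < κ.ord ∧ ∀ ξ, d ξ γ < b := by
    intro γ
    by_cases hγ : γ < κ.ord
    · obtain ⟨b, hb, hb'⟩ := exists_lt_of_family (a := κ.ord) (fun ξ => d ξ γ)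
        (by rw [hL, hκ.cof_ord, lift_lt]; exact Order.lt_succ lam) (fun ξ => hd ξ γ hγ)
      exact ⟨b, fun _ => ⟨hb, hb'⟩⟩
    · exact ⟨0, fun h => absurd h hγ⟩
  choose D hD using hsup
  -- The combined function is guessed by some candidate `ξ`; column `ξ` of that guess contradicts
  -- the choice of `G ξ`.
  obtain ⟨β, h1, h2, h3, ξ, hξ⟩ := key (fun γ ξ => G ξ γ) D (fun γ hγ => (hD γ hγ).1)
  obtain ⟨γ, hγ, hne⟩ := hG ξ β h1 h2 (fun γ hγ => ((hD γ (hγ.trans h1)).2 ξ).trans (h3 γ hγ))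
  exact hne (congrFun (hξ γ hγ) ξ)

/-! ### Order types -/

theorem otp_le_of_strictMonoOn {C D : Set Ordinal.{u}} (f : Ordinal.{u} → Ordinal.{u})
    (hf : StrictMonoOn f C) (hm : MapsTo f C D) : otp C ≤ otp D := by
  refine Ordinal.type_le_iff'.2 ⟨RelEmbedding.ofMonotone (fun x : C => (⟨f x, hm x.2⟩ : D)) ?_⟩
  intro a b hab
  exact hf a.2 b.2 hab

theorem otp_Iio (a : Ordinal.{u}) : otp (Iio a) = Ordinal.lift.{u + 1} a :=
  Ordinal.typein_ordinal a

theorem otp_inter_Iio_enumOrd {s : Set Ordinal.{u}} (hs : ¬BddAbove s) (j : Ordinal.{u}) :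
    otp (s ∩ Iio (Ordinal.enumOrd s j)) = Ordinal.lift.{u + 1} j := by
  have hmono := Ordinal.enumOrd_strictMono hs
  rw [← otp_Iio]
  refine le_antisymm ?_
    (otp_le_of_strictMonoOn _ (hmono.strictMonoOn _) fun i hi => ⟨Ordinal.enumOrd_mem hs i, hmono hi⟩)
  have hinv : ∀ x, ∃ i, x ∈ s → Ordinal.enumOrd s i = x := fun x => by
    by_cases hx : x ∈ s
    · exact (Ordinal.enumOrd_surjective hs hx).imp fun _ h _ => h
    · exact ⟨0, fun h => absurd h hx⟩
  choose f hf using hinv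
  refine otp_le_of_strictMonoOn f (fun a ha b hb hab => ?_) fun a ha => ?_
  · rwa [← hmono.lt_iff_lt, hf a ha.1, hf b hb.1]
  · rw [mem_Iio, ← hmono.lt_iff_lt, hf a ha.1]
    exact ha.2

theorem le_otp_of_limPt {C : Set Ordinal.{u}} {α : Ordinal.{u}} (hC : C ⊆ Iio α)
    (h : LimPt C α) : Ordinal.lift.{u + 1} α.cof.ord ≤ otp C := by
  by_contra! hlt
  have h1 : #C < lift.{u + 1} α.cof := by
    rw [lift_ord] at hlt
    have := lt_ord.1 hlt
    rwa [otp, Ordinal.card_type] at this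
  obtain ⟨b, hb, hb'⟩ := exists_lt_of_mk_lt_cof h1 hC
  obtain ⟨β, h1, h2, -⟩ := h.2 b hb
  exact h2.asymm (hb' β h1)

/-! ### Ladder systems -/

theorem IsCSequence.isClubIn {κ : Cardinal.{u}} {C : Ordinal.{u} → Set Ordinal.{u}}
    (hC : IsCSequence κ C) {α : Ordinal.{u}} (hα : α < κ.ord) (hlim : Order.IsSuccLimit α) :
    IsClubIn α (C α) := by
  obtain ⟨h1, h2, h3⟩ := hC α hα
  refine ⟨h1, limPt_iff_sSup.2 ⟨?_, hlim.bot_lt⟩, fun δ hδ h => h2 δ hδ h.1 (limPt_iff_sSup.1 h).1⟩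
  rw [inter_eq_left.2 h1, h3]
  have := (limPt_iff_sSup (C := univ) (δ := α)).1
    ⟨hlim.bot_lt, fun γ hγ => ⟨_, mem_univ _, Order.lt_succ γ, hlim.succ_lt hγ⟩⟩
  rw [univ_inter] at this
  exact this.1

/-- `C δ` is an initial segment of `C α` for every limit point `δ < α` of `C α`. -/
def CoherentAt (C : Ordinal.{u} → Set Ordinal.{u}) (α : Ordinal.{u}) : Prop :=
  ∀ δ < α, LimPt (C α) δ → C δ = C α ∩ Iio δ

/-- A ladder cofinal in an ordinal of cofinality `lam` has order type at least `lam`, which excludes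
the second alternative of `⊑_lam`. -/
theorem coherentAt_of_cof_eq {κ lam : Cardinal.{u}} (hunc : ℵ₀ < lam)
    {C : Ordinal.{u} → Set Ordinal.{u}} (hC : IsCSequence κ C)
    (hcoh : IsCoherent κ (InitialSegMod lam) C) {α : Ordinal.{u}} (hα : α < κ.ord)
    (hcof : α.cof = lam) : CoherentAt C α := by
  intro δ hδ h
  have hcl := hC.isClubIn hα (isSuccLimit_of_cof_eq hunc hcof)
  rcases hcoh α hα δ (mem_acc_iff.2 ⟨hcl.closed δ hδ h, h⟩) with ⟨β, hβ⟩ | h'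
  · have hδC := hC.isClubIn (hδ.trans hα) h.isSuccLimit
    rcases lt_or_ge β δ with hlt | hge
    · obtain ⟨x, h1, h2, -⟩ := hδC.limPt.2 β hlt
      rw [hβ] at h1
      exact absurd h1.2 h2.not_gt
    · ext x
      constructor
      · intro hx
        exact ⟨(hβ ▸ hx : x ∈ C α ∩ Iio β).1, hδC.subset hx⟩
      · intro hx
        rw [hβ]
        exact ⟨hx.1, hx.2.trans_le hge⟩
  · have := le_otp_of_limPt hcl.subset hcl.limPt
    rw [hcof] at this
    exact absurd h'.1 this.not_gt

open Classical in
/-- The ladder at `α` derived from a `C`-sequence: if `α` belongs to a block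
`(lam * ζ, lam * (ζ + 1)]`, it is the interval `[lam * ζ, α)`; otherwise `α = lam * ξ` for a limit
ordinal `ξ`, and it is the image of `C ξ` under multiplication by `lam`. -/
noncomputable def ladder (lam : Cardinal.{u}) (C : Ordinal.{u} → Set Ordinal.{u})
    (α : Ordinal.{u}) : Set Ordinal.{u} :=
  if h : ∃ ζ, lam.ord * ζ < α ∧ α ≤ lam.ord * (ζ + 1) then Ico (lam.ord * h.choose) α
  else (lam.ord * ·) '' C (α / lam.ord)

theorem ladder_of_block {lam : Cardinal.{u}} {C : Ordinal.{u} → Set Ordinal.{u}}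
    {α ζ : Ordinal.{u}} (h1 : lam.ord * ζ < α) (h2 : α ≤ lam.ord * (ζ + 1)) :
    ladder lam C α = Ico (lam.ord * ζ) α := by
  have h : ∃ ζ, lam.ord * ζ < α ∧ α ≤ lam.ord * (ζ + 1) := ⟨ζ, h1, h2⟩
  rw [ladder, dif_pos h]
  have aux : ∀ a b : Ordinal.{u}, lam.ord * a < α → α ≤ lam.ord * (b + 1) → a ≤ b := by
    intro a b ha hb
    have := (lt_of_mul_lt_mul_left' (ha.trans_le hb))
    exact Order.lt_add_one_iff.1 this
  rw [le_antisymm (aux _ _ h.choose_spec.1 h2) (aux _ _ h1 h.choose_spec.2)]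

theorem ladder_mul {lam : Cardinal.{u}} (hlam : 0 < lam) {C : Ordinal.{u} → Set Ordinal.{u}}
    {ξ : Ordinal.{u}} (hξ : Order.IsSuccLimit ξ) :
    ladder lam C (lam.ord * ξ) = (lam.ord * ·) '' C ξ := by
  rw [ladder, dif_neg, Ordinal.mul_div_cancel _ (ord_pos.2 hlam).ne']
  rintro ⟨ζ, h1, h2⟩
  have h3 : ζ < ξ := lt_of_mul_lt_mul_left' h1
  have h4 : ζ + 1 < ξ := hξ.succ_lt h3
  exact h2.not_gt (mul_lt_mul_of_pos_left h4 (ord_pos.2 hlam))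

theorem block_or_mul_limit {lam : Cardinal.{u}} (hlam : 0 < lam) {α : Ordinal.{u}} (hα : 0 < α) :
    (∃ ζ, lam.ord * ζ < α ∧ α ≤ lam.ord * (ζ + 1)) ∨
      ∃ ξ, Order.IsSuccLimit ξ ∧ α = lam.ord * ξ := by
  have hpos := ord_pos.2 hlam
  by_cases h : ∃ ζ, lam.ord * ζ < α ∧ α ≤ lam.ord * (ζ + 1)
  · exact Or.inl h
  · right
    push Not at h
    have h1 : lam.ord * (α / lam.ord) = α := by
      refine (Ordinal.mul_div_le _ _).antisymm ?_
      by_contra! hlt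
      exact (h _ hlt).not_gt (Ordinal.lt_mul_succ_div α hpos.ne')
    refine ⟨α / lam.ord, ⟨fun h0 => ?_, fun ζ hζ => ?_⟩, h1.symm⟩
    · rw [h0.eq_bot] at h1
      simp at h1
      exact hα.ne h1
    · have h2 : lam.ord * ζ < α := by
        rw [← h1]
        exact mul_lt_mul_of_pos_left hζ.lt hpos
      have h3 := h ζ h2
      rw [← h1] at h3
      exact hζ.2 (Order.lt_succ ζ) (lt_of_mul_lt_mul_left' h3)

theorem limPt_image_mul {lam : Cardinal.{u}} (hlam : 0 < lam) {C : Set Ordinal.{u}}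
    {δ : Ordinal.{u}} (h : LimPt ((lam.ord * ·) '' C) δ) :
    ∃ η, δ = lam.ord * η ∧ LimPt C η := by
  have hpos := ord_pos.2 hlam
  have h1 : lam.ord * (δ / lam.ord) = δ := by
    refine (Ordinal.mul_div_le _ _).antisymm ?_
    by_contra! hlt
    obtain ⟨_, ⟨ζ, -, rfl⟩, h2, h3⟩ := h.2 _ hlt
    have h4 : δ / lam.ord < ζ := lt_of_mul_lt_mul_left' h2
    have h5 : ζ < δ / lam.ord + 1 :=
      lt_of_mul_lt_mul_left' (h3.trans (Ordinal.lt_mul_succ_div δ hpos.ne'))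
    exact (Order.lt_add_one_iff.1 h5).not_gt h4
  refine ⟨δ / lam.ord, h1.symm, ?_, fun γ hγ => ?_⟩
  · rw [pos_iff_ne_zero]
    intro h0
    rw [h0, mul_zero] at h1
    exact h.1.ne h1
  · obtain ⟨_, ⟨ζ, hζ, rfl⟩, h2, h3⟩ := h.2 (lam.ord * γ) (by
      rw [← h1]; exact mul_lt_mul_of_pos_left hγ hpos)
    rw [← h1] at h3
    exact ⟨ζ, hζ, lt_of_mul_lt_mul_left' h2, lt_of_mul_lt_mul_left' h3⟩

theorem isClubIn_image_mul {lam : Cardinal.{u}} (hlam : 0 < lam) {C : Set Ordinal.{u}}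
    {ξ : Ordinal.{u}} (h : IsClubIn ξ C) : IsClubIn (lam.ord * ξ) ((lam.ord * ·) '' C) := by
  have hpos := ord_pos.2 hlam
  refine ⟨?_, ⟨?_, fun γ hγ => ?_⟩, fun δ hδ hlim => ?_⟩
  · rintro _ ⟨x, hx, rfl⟩
    exact mul_lt_mul_of_pos_left (h.subset hx) hpos
  · exact mul_pos hpos h.limPt.1
  · have h1 : γ / lam.ord < ξ := (Ordinal.lt_mul_iff_div_lt hpos.ne').1 hγ
    obtain ⟨β, h2, h3, h4⟩ := h.limPt.2 _ h1
    refine ⟨_, ⟨β, h2, rfl⟩, ?_, mul_lt_mul_of_pos_left h4 hpos⟩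
    exact (Ordinal.lt_mul_succ_div γ hpos.ne').trans_le
      (mul_le_mul_right (Order.succ_le_of_lt h3) _)
  · obtain ⟨η, rfl, hη⟩ := limPt_image_mul hlam hlim
    exact ⟨η, h.closed η (lt_of_mul_lt_mul_left' hδ) hη, rfl⟩

/-- The properties of ladder systems used in the construction. -/
structure IsLadder (lam κ : Cardinal.{u}) (C : Ordinal.{u} → Set Ordinal.{u}) : Prop where
  club : ∀ α < κ.ord, Order.IsSuccLimit α → IsClubIn α (C α)
  coherent : ∀ α < κ.ord, α.cof = lam → CoherentAt C α
  coherent_or : ∀ α < κ.ord, Order.IsSuccLimit α →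
    CoherentAt C α ∨ (α.cof < lam ∧ ∀ γ < α, γ + lam.ord < α)

/-- The reason for stretching by `lam`: inside a block the intervals cohere trivially, so coherence
can fail only at some `lam * ξ` with `ξ` a limit and cofinality below `lam`. Below such an ordinal
there is always room for `lam` further levels, which normality needs. -/
theorem isLadder_ladder {lam : Cardinal.{u}} (hunc : ℵ₀ < lam)
    {C : Ordinal.{u} → Set Ordinal.{u}} (hC : IsCSequence (Order.succ lam) C)
    (hcoh : IsCoherent (Order.succ lam) (InitialSegMod lam) C) :
    IsLadder lam (Order.succ lam) (ladder lam C) := by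
  have hlam : 0 < lam := aleph0_pos.trans hunc
  have hpos := ord_pos.2 hlam
  have hblock : ∀ α ζ : Ordinal.{u}, lam.ord * ζ < α → α ≤ lam.ord * (ζ + 1) →
      CoherentAt (ladder lam C) α := by
    intro α ζ h1 h2 δ hδ h
    rw [ladder_of_block h1 h2] at h ⊢
    obtain ⟨x, hx, -, hx'⟩ := h.2 0 h.1
    rw [ladder_of_block (hx.1.trans_lt hx') (hδ.le.trans h2)]
    ext y
    exact ⟨fun hy => ⟨⟨hy.1, hy.2.trans hδ⟩, hy.2⟩, fun hy => ⟨hy.1.1, hy.2⟩⟩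
  have hcoherent : ∀ α < (Order.succ lam).ord, α.cof = lam → CoherentAt (ladder lam C) α := by
    intro α hα hcof
    rcases block_or_mul_limit hlam (isSuccLimit_of_cof_eq hunc hcof).bot_lt with
      ⟨ζ, h1, h2⟩ | ⟨ξ, hξ, rfl⟩
    · exact hblock α ζ h1 h2
    · intro δ hδ h
      rw [ladder_mul hlam hξ] at h ⊢
      obtain ⟨η, rfl, hη⟩ := limPt_image_mul hlam h
      rw [Ordinal.cof_mul hpos.ne' hξ.isSuccPrelimit] at hcof
      have h3 := coherentAt_of_cof_eq hunc hC hcoh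
        ((Ordinal.le_mul_right ξ hpos).trans_lt hα) hcof η
        (lt_of_mul_lt_mul_left' hδ) hη
      rw [ladder_mul hlam hη.isSuccLimit, h3]
      ext y
      constructor
      · rintro ⟨x, hx, rfl⟩
        exact ⟨⟨x, hx.1, rfl⟩, mul_lt_mul_of_pos_left hx.2 hpos⟩
      · rintro ⟨⟨x, hx, rfl⟩, hx'⟩
        exact ⟨x, ⟨hx, lt_of_mul_lt_mul_left' (mem_Iio.1 hx')⟩, rfl⟩
  refine ⟨fun α hα hlim => ?_, hcoherent, fun α hα hlim => ?_⟩
  · rcases block_or_mul_limit hlam hlim.bot_lt with ⟨ζ, h1, h2⟩ | ⟨ξ, hξ, rfl⟩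
    · rw [ladder_of_block h1 h2]
      refine ⟨fun x hx => hx.2, ⟨hlim.bot_lt, fun γ hγ => ?_⟩, fun δ hδ h => ⟨?_, hδ⟩⟩
      · refine ⟨max (lam.ord * ζ) (Order.succ γ), ⟨le_max_left _ _, ?_⟩,
          (Order.lt_succ γ).trans_le (le_max_right _ _), ?_⟩
        all_goals exact max_lt h1 (hlim.succ_lt hγ)
      · obtain ⟨x, hx, -, hx'⟩ := h.2 0 h.1
        exact hx.1.trans hx'.le
    · rw [ladder_mul hlam hξ]
      exact isClubIn_image_mul hlam
        (hC.isClubIn ((Ordinal.le_mul_right ξ hpos).trans_lt hα) hξ)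
  · rcases block_or_mul_limit hlam hlim.bot_lt with ⟨ζ, h1, h2⟩ | ⟨ξ, hξ, rfl⟩
    · exact Or.inl (hblock α ζ h1 h2)
    · have h1 : (lam.ord * ξ).cof ≤ lam :=
        (Ordinal.cof_le_card _).trans (Order.lt_succ_iff.1 (lt_ord.1 hα))
      rcases h1.lt_or_eq with h2 | h2
      · right
        refine ⟨h2, fun γ hγ => ?_⟩
        have h3 : γ / lam.ord < ξ := (Ordinal.lt_mul_iff_div_lt hpos.ne').1 hγ
        have h4 : γ / lam.ord + 1 + 1 < ξ := hξ.succ_lt (hξ.succ_lt h3)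
        refine lt_of_le_of_lt ?_ (mul_lt_mul_of_pos_left h4 hpos)
        rw [mul_add_one (lam.ord) (γ / lam.ord + 1)]
        gcongr
        exact (Ordinal.lt_mul_succ_div γ hpos.ne').le
      · exact Or.inl (hcoherent _ hα h2)

/-- Hitting survives the stretching because the targets are fixed points of multiplication by `lam`:
when `lam * α = α`, the ladder at `α` is the image of `C α`, and a fixed point in `nacc (C α)` is a
nonlimit point of that image. -/
theorem exists_ladder_of_proxy {lam : Cardinal.{u}} (hunc : ℵ₀ < lam)
    (hproxy : ProxyMinus (Order.succ lam) (InitialSegMod lam) (Order.succ lam)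
      {E (Order.succ lam) lam}) :
    ∃ C : Ordinal.{u} → Set Ordinal.{u}, IsLadder lam (Order.succ lam) C ∧
      ∀ B : Ordinal.{u} → Set Ordinal.{u},
        (∀ i < (Order.succ lam).ord, ∀ γ < (Order.succ lam).ord,
          ∃ β ∈ B i, γ < β ∧ β < (Order.succ lam).ord ∧ lam.ord * β = β) →
        ∀ d : Ordinal.{u} → Ordinal.{u},
          (∀ γ < (Order.succ lam).ord, d γ < (Order.succ lam).ord) →
          ∃ α < (Order.succ lam).ord, α.cof = lam ∧ (∀ γ < α, d γ < α) ∧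
            ∀ i < α, ∀ γ < α, ∃ β ∈ B i, β ∈ C α ∧ γ < β ∧ ¬ LimPt (C α) β := by
  have hlam : 0 < lam := aleph0_pos.trans hunc
  have hpos := ord_pos.2 hlam
  obtain ⟨C, hC, hcoh, hhit⟩ := hproxy
  refine ⟨ladder lam C, isLadder_ladder hunc hC hcoh, fun B hB d hd => ?_⟩
  have hκ : (Order.succ lam).IsRegular := isRegular_succ hunc.le
  have hmul : ∀ γ < (Order.succ lam).ord, lam.ord * γ < (Order.succ lam).ord := by
    intro γ hγ
    rw [lt_ord, Ordinal.card_mul, card_ord, Order.lt_succ_iff]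
    exact (mul_le_mul_right (Order.lt_succ_iff.1 (lt_ord.1 hγ)) _).trans (mul_eq_self hunc.le).le
  have hst := hhit (fun i => {β ∈ B i | β < (Order.succ lam).ord ∧ lam.ord * β = β})
    (fun i hi => ⟨fun β hβ => hβ.2.1, fun γ hγ =>
      let ⟨β, h1, h2, h3⟩ := hB i hi γ hγ; ⟨β, ⟨h1, h3⟩, h2.le⟩⟩) _ rfl
  obtain ⟨α, ⟨⟨h1, h2⟩, h3⟩, h4, -, h5⟩ := hst.exists_closure_point hκ
    (hunc.trans (Order.lt_succ lam)) (fun γ => max (d γ) (lam.ord * γ))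
    (fun γ hγ => max_lt (hd γ hγ) (hmul γ hγ))
  refine ⟨α, h1, h2, fun γ hγ => (le_max_left _ _).trans_lt (h5 γ hγ), fun i hi γ hγ => ?_⟩
  have hlim := isSuccLimit_of_cof_eq hunc h2
  have hα : lam.ord * α = α := by
    refine le_antisymm ?_ (Ordinal.le_mul_right α hpos)
    rw [Ordinal.mul_le_iff_of_isSuccLimit hlim]
    exact fun b hb => ((le_max_right _ _).trans_lt (h5 b hb)).le
  have hlad : ladder lam C α = (lam.ord * ·) '' C α := by
    conv_lhs => rw [← hα]
    exact ladder_mul hlam hlim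
  have h6 := h3 i (lt_min hi (hi.trans h1))
  rw [← h6] at hγ
  obtain ⟨β, ⟨h7, h8, -, h9⟩, h10⟩ := exists_lt_of_lt_csSup' hγ
  refine ⟨β, h8, ?_, h10, ?_⟩
  · rw [hlad]
    exact ⟨β, h7.1, h9⟩
  · rw [hlad]
    intro hl
    obtain ⟨η, h11, h12⟩ := limPt_image_mul hlam hl
    have : η = β := by
      rw [← h9] at h11
      exact (mul_right_injective₀ hpos.ne' h11).symm
    exact h7.2 (mem_acc_iff.2 ⟨h7.1, this ▸ h12⟩)

/-! ### Guessing along a ladder system -/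

/-- The inverse of `Ordinal.lift` on its range. -/
noncomputable def unlift (o : Ordinal.{u + 1}) : Ordinal.{u} :=
  sInf {a | o ≤ Ordinal.lift.{u + 1} a}

theorem unlift_lift (a : Ordinal.{u}) : unlift (Ordinal.lift.{u + 1} a) = a := by
  simp only [unlift, Ordinal.lift_le]
  exact csInf_Ici

theorem otp_ladder_le {lam : Cardinal.{u}} (hunc : ℵ₀ < lam)
    {C : Ordinal.{u} → Set Ordinal.{u}}
    (hotp : ∀ α < (Order.succ lam).ord, otp (C α) ≤ Ordinal.lift.{u + 1} lam.ord)
    {α : Ordinal.{u}} (hα : α < (Order.succ lam).ord) (h0 : 0 < α) :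
    otp (ladder lam C α) ≤ Ordinal.lift.{u + 1} lam.ord := by
  have hlam : 0 < lam := aleph0_pos.trans hunc
  have hpos := ord_pos.2 hlam
  rcases block_or_mul_limit hlam h0 with ⟨ζ, h1, h2⟩ | ⟨ξ, hξ, rfl⟩
  · rw [ladder_of_block h1 h2, ← otp_Iio]
    refine otp_le_of_strictMonoOn (fun γ => γ - lam.ord * ζ) (fun a ha b hb hab => ?_) fun a ha => ?_
    · rw [← add_lt_add_iff_left (lam.ord * ζ), Ordinal.add_sub_cancel_of_le ha.1,
        Ordinal.add_sub_cancel_of_le hb.1]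
      exact hab
    · rw [mem_Iio, ← add_lt_add_iff_left (lam.ord * ζ), Ordinal.add_sub_cancel_of_le ha.1,
        ← mul_add_one]
      exact ha.2.trans_le h2
  · rw [ladder_mul hlam hξ]
    refine le_trans ?_ (hotp ξ ((Ordinal.le_mul_right ξ hpos).trans_lt hα))
    refine otp_le_of_strictMonoOn (fun γ => γ / lam.ord) ?_ ?_
    · rintro _ ⟨x, -, rfl⟩ _ ⟨y, -, rfl⟩ hxy
      simp only [Ordinal.mul_div_cancel _ hpos.ne']
      exact lt_of_mul_lt_mul_left' hxy
    · rintro _ ⟨x, hx, rfl⟩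
      simp only [Ordinal.mul_div_cancel _ hpos.ne']
      exact hx

/-- At cofinality `lam` the ladder is enumerated continuously in order type `lam`, which turns a
function on it into one on `lam`, where `◇(lam)` applies. The guess at `δ` cannot depend on `α`, so
it uses only order types inside `D δ`; by coherence these are the positions in the ladder of `α`. -/
theorem exists_guessing_ladder {lam : Cardinal.{u}} (hreg : lam.IsRegular) (hunc : ℵ₀ < lam)
    (hsquare : BaumgartnerSquare lam) (hdiamond : Diamond lam) :
    ∃ (D : Ordinal.{u} → Set Ordinal.{u}) (F : Ordinal.{u} → Ordinal.{u} → Ordinal.{u}),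
      (∀ α < (Order.succ lam).ord, Order.IsSuccLimit α → D α ⊆ Iio α ∧ LimPt (D α) α) ∧
      ∀ α < (Order.succ lam).ord, α.cof = lam → ∀ g d : Ordinal.{u} → Ordinal.{u},
        (∀ γ < α, g γ < lam.ord) → (∀ γ < α, d γ < α) →
        ∃ δ < α, Order.IsSuccLimit δ ∧ δ.cof < lam ∧ ∀ γ ∈ D δ, d γ < δ ∧ g γ = F δ γ := by
  obtain ⟨C, hC, hcoh, hotp⟩ := hsquare
  obtain ⟨f, hf⟩ := hdiamond
  have hlad := isLadder_ladder hunc hC hcoh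
  set D := ladder lam C with hD
  refine ⟨D, fun δ γ => f (unlift (otp (D δ))) (unlift (otp (D δ ∩ Iio γ))),
    fun α hα hlim => ⟨(hlad.club α hα hlim).subset, (hlad.club α hα hlim).limPt⟩,
    fun α hα hcof g d hg hd => ?_⟩
  have hlim := isSuccLimit_of_cof_eq hunc hcof
  have hcl := hlad.club α hα hlim
  have hco := hlad.coherent α hα hcof
  -- `enumOrd` wants an unbounded set; the padding changes nothing below `α`.
  let s := D α ∪ Ici α
  have hs : ¬BddAbove s := by
    rintro ⟨b, hb⟩
    have := hb (Or.inr (le_max_left α (Order.succ b)) : max α (Order.succ b) ∈ s)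
    exact (Order.lt_succ b).not_ge ((le_max_right _ _).trans this)
  have hsα : ∀ δ ≤ α, s ∩ Iio δ = D α ∩ Iio δ := by
    intro δ hδ
    ext x
    constructor
    · rintro ⟨hx | hx, hx'⟩
      · exact ⟨hx, hx'⟩
      · exact absurd (hx'.trans_le hδ) (not_lt.2 hx)
    · rintro ⟨hx, hx'⟩
      exact ⟨Or.inl hx, hx'⟩
  let h := Ordinal.enumOrd s
  have hmono : StrictMono h := Ordinal.enumOrd_strictMono hs
  have hnormal : Order.IsNormal h := by
    refine Ordinal.isNormal_enumOrd (fun t ht htne htb => ?_) hs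
    by_cases hα' : α ≤ sSup t
    · exact Or.inr hα'
    · push Not at hα'
      left
      have hsub : ∀ x ∈ t, x ∈ D α := fun x hx => (ht hx).resolve_right fun hx' =>
        hα'.not_ge (le_trans hx' (le_csSup htb hx))
      by_cases hmem : sSup t ∈ t
      · exact hsub _ hmem
      · refine hcl.closed _ hα' ⟨?_, fun γ hγ => ?_⟩
        · obtain ⟨x, hx⟩ := htne
          rw [pos_iff_ne_zero]
          intro h0
          have : x = sSup t := le_antisymm (le_csSup htb hx) (h0 ▸ zero_le)
          exact hmem (this ▸ hx)
        · obtain ⟨x, hx, hγx⟩ := exists_lt_of_lt_csSup htne hγ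
          exact ⟨x, hsub x hx, hγx, (le_csSup htb hx).lt_of_ne fun h => hmem (h ▸ hx)⟩
  have hotps : ∀ j, h j ≤ α → otp (D α ∩ Iio (h j)) = Ordinal.lift.{u + 1} j := by
    intro j hj
    rw [← hsα _ hj]
    exact otp_inter_Iio_enumOrd hs j
  obtain ⟨τ, hτ⟩ : ∃ τ, h τ = α := Ordinal.enumOrd_surjective hs (Or.inr (le_refl α))
  -- The upper bound is the order type clause of the square, the lower bound is the cofinality of
  -- `α`.
  have hτ' : τ = lam.ord := by
    have h1 : otp (D α) = Ordinal.lift.{u + 1} τ := by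
      rw [← hotps τ hτ.le, hτ, inter_eq_left.2 hcl.subset]
    apply le_antisymm
    · rw [← Ordinal.lift_le.{u + 1}, ← h1]
      exact otp_ladder_le hunc hotp hα hlim.bot_lt
    · rw [← Ordinal.lift_le.{u + 1}, ← h1, ← hcof]
      exact le_otp_of_limPt hcl.subset hcl.limPt
  subst hτ'
  have hlt : ∀ j < lam.ord, h j < α := fun j hj => hτ ▸ hmono hj
  have hmem : ∀ j < lam.ord, h j ∈ D α := fun j hj =>
    (Ordinal.enumOrd_mem hs j).resolve_right (not_le.2 (hlt j hj))
  have hsurj : ∀ x ∈ D α, ∃ j < lam.ord, h j = x := by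
    intro x hx
    obtain ⟨j, hj⟩ := Ordinal.enumOrd_surjective hs (Or.inl hx : x ∈ s)
    refine ⟨j, ?_, hj⟩
    rw [← hmono.lt_iff_lt, hτ]
    exact hj.trans_lt (hcl.subset hx)
  -- A position past `j` whose point lies beyond `d (h j)`: closure points of this map are limits,
  -- and `d` sends ladder points below their image to ordinals below it.
  have hstep : ∀ j, ∃ j', j < lam.ord → j' < lam.ord ∧ j < j' ∧ d (h j) < h j' := by
    intro j
    by_cases hj : j < lam.ord
    · obtain ⟨x, hx, hx', -⟩ := hcl.limPt.2 _ (max_lt (hd _ (hlt j hj)) (hlt j hj))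
      obtain ⟨j', h1, rfl⟩ := hsurj x hx
      exact ⟨j', fun _ => ⟨h1, hmono.lt_iff_lt.1 ((le_max_right _ _).trans_lt hx'),
        (le_max_left _ _).trans_lt hx'⟩⟩
    · exact ⟨0, fun h => absurd h hj⟩
  choose e he using hstep
  obtain ⟨β, h1, h2, h3, h4⟩ := (hf (fun j => g (h j)) fun j hj => hg _ (hlt j hj)).exists_closure_point
    hreg hunc e (fun j hj => (he j hj).1)
  have hβlim : Order.IsSuccLimit β := by
    refine ⟨fun h0 => h2.ne (h0.eq_bot).symm, fun γ hγ => ?_⟩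
    exact hγ.2 (he γ (hγ.lt.trans h3)).2.1 (h4 γ hγ.lt)
  have hδ : LimPt (D α) (h β) := by
    refine ⟨zero_le.trans_lt (hmono h2), fun γ hγ => ?_⟩
    obtain ⟨j, hj, hγj⟩ := (hnormal.lt_iff_exists_lt hβlim).1 hγ
    exact ⟨h j, hmem j (hj.trans h3), hγj, hmono hj⟩
  have hDδ := hco (h β) (hlt β h3) hδ
  refine ⟨h β, hlt β h3, hδ.isSuccLimit, ?_, fun γ hγ => ?_⟩
  · rw [Ordinal.cof_map_of_isNormal hnormal hβlim]
    exact (Ordinal.cof_le_card β).trans_lt (lt_ord.1 h3)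
  · rw [hDδ] at hγ
    obtain ⟨j, hj, rfl⟩ := hsurj γ hγ.1
    have hjβ : j < β := hmono.lt_iff_lt.1 hγ.2
    refine ⟨(he j hj).2.2.trans (hmono (h4 j hjβ)), ?_⟩
    have h5 : D α ∩ Iio (h β) ∩ Iio (h j) = D α ∩ Iio (h j) := by
      rw [inter_assoc, Iio_inter_Iio, min_eq_right (hmono hjβ).le]
    simp only [hDδ]
    rw [h5, hotps _ (hlt β h3).le, hotps _ (hlt j hj).le, unlift_lift, unlift_lift]
    exact h1 j hjβ

/-! ### Restrictions of binary sequences -/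

/-- The restriction of `t` to the ordinal `γ`. -/
def res (γ : Ordinal.{u}) (t : Ordinal.{u} → Bool) : BinSeq.{u} := ⟨γ, fun i => t i.1⟩

open Classical in
/-- The extension of a binary sequence by zeros. -/
noncomputable def BinSeq.bit (s : BinSeq.{u}) : Ordinal.{u} → Bool :=
  fun i => if h : i < s.len then s.val ⟨i, h⟩ else false

@[simp] theorem res_len (γ : Ordinal.{u}) (t : Ordinal.{u} → Bool) : (res γ t).len = γ := rfl

theorem bit_res {γ : Ordinal.{u}} {t : Ordinal.{u} → Bool} {i : Ordinal.{u}} (h : i < γ) :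
    (res γ t).bit i = t i := dif_pos h

theorem bit_res_of_le {γ : Ordinal.{u}} {t : Ordinal.{u} → Bool} {i : Ordinal.{u}} (h : γ ≤ i) :
    (res γ t).bit i = false := dif_neg h.not_gt

theorem res_bit (s : BinSeq.{u}) : res s.len s.bit = s := by
  obtain ⟨a, f⟩ := s
  simp only [res, BinSeq.bit]
  congr 1
  funext i
  exact dif_pos i.2

theorem res_eq_res {γ : Ordinal.{u}} {t t' : Ordinal.{u} → Bool} :
    res γ t = res γ t' ↔ ∀ i < γ, t i = t' i := by
  constructor
  · intro h i hi
    rw [← bit_res (t := t) hi, h, bit_res hi]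
  · intro h
    simp only [res]
    congr 1
    funext i
    exact h i i.2

theorem res_le_res {γ γ' : Ordinal.{u}} {t t' : Ordinal.{u} → Bool} :
    res γ t ≤ res γ' t' ↔ γ ≤ γ' ∧ ∀ i < γ, t' i = t i :=
  ⟨fun ⟨h, h'⟩ => ⟨h, fun i hi => h' ⟨i, hi⟩⟩, fun ⟨h, h'⟩ => ⟨h, fun i => h' i i.2⟩⟩

/-! ### The construction -/

open Classical in
/-- An extension of `y` from `σ` satisfying `p`, which is `z` if possible. -/
noncomputable def extend (σ : Ordinal.{u}) (p : (Ordinal.{u} → Bool) → Prop)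
    (z y : Ordinal.{u} → Bool) : Ordinal.{u} → Bool :=
  if p z ∧ ∀ i < σ, z i = y i then z
  else if h : ∃ z, p z ∧ ∀ i < σ, z i = y i then h.choose else y

theorem extend_spec {σ : Ordinal.{u}} {p : (Ordinal.{u} → Bool) → Prop}
    {z y : Ordinal.{u} → Bool} (h : ∃ z, p z ∧ ∀ i < σ, z i = y i) :
    p (extend σ p z y) ∧ ∀ i < σ, extend σ p z y i = y i := by
  rw [extend]
  split_ifs with h'
  · exact h'
  · exact h.choose_spec

theorem extend_of {σ : Ordinal.{u}} {p : (Ordinal.{u} → Bool) → Prop}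
    {z y : Ordinal.{u} → Bool} (h : p z) (h' : ∀ i < σ, z i = y i) : extend σ p z y = z :=
  if_pos ⟨h, h'⟩

/-- The parameters of the construction: a ladder system `C` along which canonical branches are
built, a ladder system `D` with functions `F` guessing branches, and guesses `Ω` for the antichains
to be sealed. -/
structure TreeData where
  lam : Cardinal.{u}
  C : Ordinal.{u} → Set Ordinal.{u}
  D : Ordinal.{u} → Set Ordinal.{u}
  F : Ordinal.{u} → Ordinal.{u} → Ordinal.{u}
  Ω : Ordinal.{u} → Ordinal.{u} → Iio lam.ord → BinSeq.{u} × BinSeq.{u} × BinSeq.{u}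

open Classical in
/-- An injection of a set of at most `lam` many sequences into `lam`. -/
noncomputable def code (lam : Cardinal.{u}) (S : Set BinSeq.{u}) : BinSeq.{u} → Ordinal.{u} :=
  if h : ∃ c : BinSeq.{u} → Ordinal.{u}, InjOn c S ∧ ∀ x, c x < lam.ord then h.choose
  else fun _ => 0

theorem code_lt {lam : Cardinal.{u}} (hlam : 0 < lam) (S : Set BinSeq.{u}) (x : BinSeq.{u}) :
    code lam S x < lam.ord := by
  rw [code]
  split_ifs with h
  · exact h.choose_spec.2 x
  · exact ord_pos.2 hlam

theorem code_injOn {lam : Cardinal.{u}} (hlam : 0 < lam) {S : Set BinSeq.{u}}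
    (hS : #S ≤ lift.{u + 1} lam) : InjOn (code lam S) S := by
  have h : ∃ c : BinSeq.{u} → Ordinal.{u}, InjOn c S ∧ ∀ x, c x < lam.ord := by
    have h1 : #S ≤ #(Iio lam.ord) := by rwa [mk_Iio_ordinal, card_ord]
    obtain ⟨e⟩ := (Cardinal.le_def _ _).1 h1
    classical
    refine ⟨fun x => if hx : x ∈ S then (e ⟨x, hx⟩).1 else 0, fun x hx y hy hxy => ?_, fun x => ?_⟩
    · simp only [dif_pos hx, dif_pos hy] at hxy
      exact congrArg Subtype.val (e.injective (Subtype.ext hxy))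
    · by_cases hx : x ∈ S
      · simpa only [dif_pos hx] using mem_Iio.1 (e ⟨x, hx⟩).2
      · simpa only [dif_neg hx] using ord_pos.2 hlam
  rw [code, dif_pos h]
  exact h.choose_spec.1

/-- The next element of `C` above `i`. -/
noncomputable def nx (C : Set Ordinal.{u}) (i : Ordinal.{u}) : Ordinal.{u} :=
  sInf {γ ∈ C | i < γ}

/-- The last element of `C` below or equal to `i`. -/
noncomputable def pv (C : Set Ordinal.{u}) (i : Ordinal.{u}) : Ordinal.{u} :=
  sSup (C ∩ Iic i)

theorem pv_le (C : Set Ordinal.{u}) (i : Ordinal.{u}) : pv C i ≤ i :=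
  csSup_le' fun _ hx => hx.2

theorem nx_le {C : Set Ordinal.{u}} {i γ : Ordinal.{u}} (h : γ ∈ C) (h' : i < γ) : nx C i ≤ γ :=
  csInf_le' ⟨h, h'⟩

theorem le_pv {C : Set Ordinal.{u}} {i γ : Ordinal.{u}} (h : γ ∈ C) (h' : γ ≤ i) : γ ≤ pv C i :=
  le_csSup ⟨i, fun _ hx => hx.2⟩ ⟨h, h'⟩

theorem nx_le_pv {C : Set Ordinal.{u}} {i j : Ordinal.{u}} (h : j < pv C i) : nx C j ≤ pv C i := by
  obtain ⟨c, hc, hjc⟩ := exists_lt_of_lt_csSup' h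
  exact (nx_le hc.1 hjc).trans (le_pv hc.1 hc.2)

theorem lt_nx_of_lt_pv {C : Set Ordinal.{u}} {i j : Ordinal.{u}} (h : j < pv C i) :
    j < nx C j := by
  obtain ⟨c, hc, hjc⟩ := exists_lt_of_lt_csSup' h
  exact (csInf_mem (s := {γ ∈ C | j < γ}) ⟨c, hc.1, hjc⟩).2

namespace IsClubIn
variable {α : Ordinal.{u}} {C : Set Ordinal.{u}} (h : IsClubIn α C) {i : Ordinal.{u}}
include h

theorem nx_spec (hi : i < α) : nx C i ∈ C ∧ i < nx C i := by
  obtain ⟨ε, h1, h2, -⟩ := h.exists_ge hi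
  exact csInf_mem (s := {γ ∈ C | i < γ}) ⟨ε, h1, h2⟩

theorem nx_lt (hi : i < α) : nx C i < α := h.subset (h.nx_spec hi).1

theorem pv_mem {ε : Ordinal.{u}} (hε : ε ∈ C) (hεi : ε ≤ i) (hi : i < α) : pv C i ∈ C := by
  by_contra hn
  refine hn (h.closed _ ((pv_le C i).trans_lt hi) ⟨?_, fun γ hγ => ?_⟩)
  · refine zero_le.trans_lt ((le_pv hε hεi).lt_of_ne fun h => hn (h ▸ hε))
  · obtain ⟨c, hc, hγc⟩ := exists_lt_of_lt_csSup' hγ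
    exact ⟨c, hc.1, hγc, (le_pv hc.1 hc.2).lt_of_ne fun h => hn (h ▸ hc.1)⟩

/-- There is no point of `C` strictly between `pv C i₀` and `nx C i₀`, so one step of a walk
determines all bits of this interval. -/
theorem block {ε i₀ : Ordinal.{u}} (hε : ε ∈ C) (hεi : ε ≤ i₀) (hi₀ : i₀ < α)
    (h1 : pv C i₀ ≤ i) (h2 : i < nx C i₀) : nx C i = nx C i₀ ∧ pv C i = pv C i₀ := by
  have aux : ∀ c ∈ C, c ≤ i → c ≤ i₀ := fun c hc hci => by
    by_contra! h
    exact (nx_le hc h).not_gt (hci.trans_lt h2)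
  have hi : i < α := h2.trans (h.nx_lt hi₀)
  constructor
  · refine le_antisymm (nx_le (h.nx_spec hi₀).1 h2) (nx_le (h.nx_spec hi).1 ?_)
    by_contra! h'
    exact ((le_pv (h.nx_spec hi).1 h').trans h1).not_gt (h.nx_spec hi).2
  · exact le_antisymm (csSup_le' fun c hc => le_pv hc.1 (aux c hc.1 hc.2))
      (le_pv (h.pv_mem hε hεi hi₀) h1)

end IsClubIn

/-! ### Canonical walks and the recursive definition of the trees -/

namespace TreeData
variable (P : TreeData.{u})

/-- `Z` chooses nodes of length `γ` which extend the nodes given by `Y` at `σ` for the guessed tuple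
and such that the resulting tuple extends a member of the guessed antichain. -/
def SealCond (g : (Ordinal.{u} → Bool) → (Ordinal.{u} → Bool) → Prop) (γ σ : Ordinal.{u})
    (Y : (Ordinal.{u} → Bool) → BinSeq.{u} → Ordinal.{u} → Bool)
    (Z : BinSeq.{u} → Ordinal.{u} → Bool) : Prop :=
  ∃ η : Iio P.lam.ord → Ordinal.{u} → Bool,
    (∀ j, ∀ γ' < γ, res γ' (η j) = (P.Ω γ γ' j).1) ∧
    (∀ j, g (η j) (Z (res γ (η j))) ∧
      ∀ i < σ, Z (res γ (η j)) i = Y (η j) (P.Ω γ 0 j).2.1 i) ∧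
    ∃ γ' < γ, ∀ j, (P.Ω γ γ' j).2.2 ≤ res γ (Z (res γ (η j)))

open Classical in
/-- A choice of nodes as in `SealCond`. -/
noncomputable def sealing (g : (Ordinal.{u} → Bool) → (Ordinal.{u} → Bool) → Prop)
    (γ σ : Ordinal.{u}) (Y : (Ordinal.{u} → Bool) → BinSeq.{u} → Ordinal.{u} → Bool) :
    BinSeq.{u} → Ordinal.{u} → Bool :=
  if h : ∃ Z, P.SealCond g γ σ Y Z then h.choose else BinSeq.bit

variable (G : Ordinal.{u} → (Ordinal.{u} → Bool) → (Ordinal.{u} → Bool) → Prop)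

open Classical in
/-- The bits of the canonical branch along `C` through the node `x` of the tree given by `η`. -/
noncomputable def pathBit (C : Set Ordinal.{u}) (i : Ordinal.{u}) (η : Ordinal.{u} → Bool)
    (x : BinSeq.{u}) : Bool :=
  -- Beyond `x`, bit `i` belongs to the step from `pv C i` to `nx C i`. The guard `i' < i` follows
  -- from `pv C i ≤ i` and serves only termination.
  if i < x.len then x.bit i else
    extend (pv C i) (G (nx C i) η)
      (P.sealing (G (nx C i)) (nx C i) (pv C i) (fun η x i' =>
        if _h : i' < pv C i ∧ i' < i then pathBit C i' η x else false) (res (nx C i) η))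
      (fun i' => if _h : i' < pv C i ∧ i' < i then pathBit C i' η x else false) i
termination_by i
decreasing_by all_goals exact _h.2

/-- The canonical branch along `C` through the node `x` of the tree given by `η`. -/
noncomputable def path (C : Set Ordinal.{u}) (η : Ordinal.{u} → Bool) (x : BinSeq.{u}) :
    Ordinal.{u} → Bool :=
  fun i => P.pathBit G C i η x

/-- The node used by the canonical branch along `C` at the step from `σ` to `γ`. -/
noncomputable def step (C : Set Ordinal.{u}) (γ σ : Ordinal.{u}) (η : Ordinal.{u} → Bool)
    (x : BinSeq.{u}) : Ordinal.{u} → Bool :=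
  extend σ (G γ η) (P.sealing (G γ) γ σ (fun η x => (res σ (P.path G C η x)).bit) (res γ η))
    (res σ (P.path G C η x)).bit

theorem path_of_lt {C : Set Ordinal.{u}} {η : Ordinal.{u} → Bool} {x : BinSeq.{u}}
    {i : Ordinal.{u}} (h : i < x.len) : P.path G C η x i = x.bit i := by
  rw [path, pathBit, if_pos h]

theorem path_of_le {C : Set Ordinal.{u}} {η : Ordinal.{u} → Bool} {x : BinSeq.{u}}
    {i : Ordinal.{u}} (h : x.len ≤ i) :
    P.path G C η x i = P.step G C (nx C i) (pv C i) η x i := by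
  classical
  have aux : ∀ η x, (fun i' => if _h : i' < pv C i ∧ i' < i then P.pathBit G C i' η x else false) =
      (res (pv C i) (P.path G C η x)).bit := by
    intro η x
    funext i'
    by_cases h' : i' < pv C i
    · rw [bit_res h', dif_pos ⟨h', h'.trans_le (pv_le C i)⟩, path]
    · rw [bit_res_of_le (not_lt.1 h'), dif_neg fun h => h' h.1]
  rw [path, pathBit, if_neg h.not_gt, step, ← aux, ← funext₂ aux]

variable {G} in
-- A walk sees its club only through `nx` and `pv`, and the tree only at levels `nx C i`. This turns
-- coherence of ladders into coherence of walks.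
theorem path_congr {G' : Ordinal.{u} → (Ordinal.{u} → Bool) → (Ordinal.{u} → Bool) → Prop}
    {C C' : Set Ordinal.{u}} {α : Ordinal.{u}}
    (h : ∀ i < α, nx C i = nx C' i ∧ pv C i = pv C' i ∧ G (nx C i) = G' (nx C i))
    (η : Ordinal.{u} → Bool) (x : BinSeq.{u}) {i : Ordinal.{u}} (hi : i < α) :
    P.path G C η x i = P.path G' C' η x i := by
  induction i using WellFoundedLT.induction generalizing η x with
  | ind i ih =>
    rcases lt_or_ge i x.len with hx | hx
    · rw [path_of_lt _ _ hx, path_of_lt _ _ hx]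
    · have aux : ∀ η x, (res (pv C i) (P.path G C η x)).bit =
          (res (pv C i) (P.path G' C' η x)).bit := by
        intro η x
        rw [res_eq_res.2]
        intro j hj
        have := hj.trans_le (pv_le C i)
        exact ih j this η x (this.trans hi)
      obtain ⟨h1, h2, h3⟩ := h i hi
      rw [path_of_le _ _ hx, path_of_le _ _ hx, step, step, ← h1, ← h2, h3]
      simp only [aux]

variable {G} in
-- The step producing bit `i`, and all earlier ones, consult `η` only below `nx C i`. Hence a
-- correct guess of a restriction of `η` can replace `η`.
theorem path_congr_left (hG : ∀ γ η η' t, (∀ i < γ, η i = η' i) → (G γ η t ↔ G γ η' t))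
    (C : Set Ordinal.{u}) {η η' : Ordinal.{u} → Bool} (x : BinSeq.{u}) {i : Ordinal.{u}}
    (hi : i < nx C i) (h : ∀ j < nx C i, η j = η' j) : P.path G C η x i = P.path G C η' x i := by
  induction i using WellFoundedLT.induction with
  | ind i ih =>
    rcases lt_or_ge i x.len with hx | hx
    · rw [path_of_lt _ _ hx, path_of_lt _ _ hx]
    · have hle : pv C i ≤ nx C i := (pv_le C i).trans hi.le
      have aux : (res (pv C i) (P.path G C η x)).bit = (res (pv C i) (P.path G C η' x)).bit := by
        rw [res_eq_res.2]
        intro j hj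
        refine ih j (hj.trans_le (pv_le C i)) (lt_nx_of_lt_pv hj) fun k hk => h k ?_
        exact (hk.trans_le (nx_le_pv hj)).trans_le hle
      rw [path_of_le _ _ hx, path_of_le _ _ hx, step, step, aux, res_eq_res.2 h,
        funext fun t => propext (hG (nx C i) η η' t h)]

/-- A step looks only at the current node, so a walk restarted from one of its later nodes is the
same walk. -/
theorem path_merge (C : Set Ordinal.{u}) (η : Ordinal.{u} → Bool) (x : BinSeq.{u})
    {ε : Ordinal.{u}} (hε : x.len ≤ ε) :
    P.path G C η (res ε (P.path G C η x)) = P.path G C η x := by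
  funext i
  induction i using WellFoundedLT.induction with
  | ind i ih =>
    rcases lt_or_ge i ε with hi | hi
    · rw [path_of_lt _ _ (by exact hi), bit_res hi]
    · rw [path_of_le _ _ (by exact hi), path_of_le _ _ (hε.trans hi), step, step,
        res_eq_res.2 fun j hj => ih j (hj.trans_le (pv_le C i))]

theorem eq_path_res {C : Set Ordinal.{u}} {η t : Ordinal.{u} → Bool} {α ε ε' : Ordinal.{u}}
    (h : ∀ i < α, t i = P.path G C η (res ε t) i) (hε : ε ≤ ε') (hε' : ε' ≤ α) :
    ∀ i < α, t i = P.path G C η (res ε' t) i := by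
  rw [res_eq_res.2 fun i hi => h i (hi.trans_le hε'), path_merge _ _ _ _ _ (by exact hε)]
  exact h

/-- The set of nodes of length `γ`. -/
def lev (g : (Ordinal.{u} → Bool) → (Ordinal.{u} → Bool) → Prop) (γ : Ordinal.{u})
    (η : Ordinal.{u} → Bool) : Set BinSeq.{u} :=
  {s | ∃ t, g η t ∧ s = res γ t}

/-- The branch `t` is removed at the limit level `α`: it is guessed by `F α` along `D α` and it is
not canonical. -/
def Kill (α : Ordinal.{u}) (η t : Ordinal.{u} → Bool) : Prop :=
  Order.IsSuccLimit α ∧ α.cof < P.lam ∧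
    (∀ γ ∈ P.D α, code P.lam (lev (G γ) γ η) (res γ t) = P.F α γ) ∧
    ¬ ∃ ε ∈ P.C α, ∀ i < α, t i = P.path G (P.C α) η (res ε t) i

/-- The restriction of `t` to `α` is a node of the tree given by `η`. -/
def Good (α : Ordinal.{u}) (η t : Ordinal.{u} → Bool) : Prop :=
  (∀ γ, (_h : γ < α) → Good γ (res α η).bit (res α t).bit) ∧
    -- Recursion allows only levels below `α` here; `good_iff` removes the guard. Truncating `η` and
    -- `t` makes the definition depend only on their restrictions to `α`.
    ¬ P.Kill (fun γ η' t' => ∃ _h : γ < α, Good γ η' t') α (res α η).bit (res α t).bit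
termination_by α

theorem good_congr {α : Ordinal.{u}} {η η' t t' : Ordinal.{u} → Bool} (h : ∀ i < α, η i = η' i)
    (h' : ∀ i < α, t i = t' i) : P.Good α η t ↔ P.Good α η' t' := by
  rw [Good, Good, res_eq_res.2 h, res_eq_res.2 h']

theorem good_congr_left {α : Ordinal.{u}} {η η' t : Ordinal.{u} → Bool}
    (h : ∀ i < α, η i = η' i) : P.Good α η t ↔ P.Good α η' t :=
  P.good_congr h fun _ _ => rfl

theorem good_congr_right {α : Ordinal.{u}} {η t t' : Ordinal.{u} → Bool}
    (h : ∀ i < α, t i = t' i) : P.Good α η t ↔ P.Good α η t' :=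
  P.good_congr (fun _ _ => rfl) h

theorem Good.mono {P : TreeData.{u}} {α γ : Ordinal.{u}} {η t : Ordinal.{u} → Bool}
    (h : P.Good α η t) (hγ : γ ≤ α) : P.Good γ η t := by
  rcases hγ.lt_or_eq with hγ | rfl
  · rw [Good] at h
    exact (P.good_congr (fun i hi => bit_res (hi.trans hγ)) fun i hi => bit_res (hi.trans hγ)).1
      (h.1 γ hγ)
  · exact h

theorem path_good_congr {C : Set Ordinal.{u}} {η η' : Ordinal.{u} → Bool} {x : BinSeq.{u}}
    {i : Ordinal.{u}} (hi : i < nx C i) (h : ∀ j < nx C i, η j = η' j) :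
    P.path P.Good C η x i = P.path P.Good C η' x i :=
  P.path_congr_left (G := P.Good) (fun _ _ _ _ h' => P.good_congr_left h') C x hi h

/-- The hypotheses on the parameters of the construction. -/
structure Valid : Prop where
  uncountable : ℵ₀ < P.lam
  power_le : ∀ c < P.lam, P.lam ^ c ≤ P.lam
  ladder : IsLadder P.lam (Order.succ P.lam) P.C
  subset_D : ∀ α < (Order.succ P.lam).ord, Order.IsSuccLimit α → P.D α ⊆ Iio α ∧ LimPt (P.D α) α
  guess : ∀ α < (Order.succ P.lam).ord, α.cof = P.lam → ∀ g d : Ordinal.{u} → Ordinal.{u},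
    (∀ γ < α, g γ < P.lam.ord) → (∀ γ < α, d γ < α) →
    ∃ δ < α, Order.IsSuccLimit δ ∧ δ.cof < P.lam ∧ ∀ γ ∈ P.D δ, d γ < δ ∧ g γ = P.F δ γ

namespace Valid
variable {P} (hP : P.Valid)
include hP

theorem lam_pos : 0 < P.lam := aleph0_pos.trans hP.uncountable

theorem isSuccLimit_succ_ord : Order.IsSuccLimit (Order.succ P.lam).ord :=
  isSuccLimit_ord (hP.uncountable.le.trans (Order.le_succ _))

/-- The guard is harmless: `D α` lies below `α`, and the bits below `α` of a walk along `C α`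
involve only levels `nx (C α) i < α`. -/
theorem good_iff {α : Ordinal.{u}} (hα : α < (Order.succ P.lam).ord) {η t : Ordinal.{u} → Bool} :
    P.Good α η t ↔ (∀ γ < α, P.Good γ η t) ∧ ¬ P.Kill P.Good α η t := by
  have h1 : (∀ γ, (_h : γ < α) → P.Good γ (res α η).bit (res α t).bit) ↔
      ∀ γ < α, P.Good γ η t :=
    forall₂_congr fun γ hγ =>
      P.good_congr (fun i hi => bit_res (hi.trans hγ)) fun i hi => bit_res (hi.trans hγ)
  have h2 : P.Kill (fun γ η' t' => ∃ _h : γ < α, P.Good γ η' t') α (res α η).bit (res α t).bit ↔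
      P.Kill P.Good α η t := by
    refine and_congr_right fun hlim => and_congr_right fun _ => ?_
    have hcl := hP.ladder.club α hα hlim
    refine and_congr (forall₂_congr fun γ hγ => ?_)
      (not_congr (exists_congr fun ε => and_congr_right fun hε => ?_))
    · have hγα := (hP.subset_D α hα hlim).1 hγ
      rw [res_eq_res.2 fun i hi => bit_res (hi.trans hγα)]
      have : lev (fun η' t' => ∃ _h : γ < α, P.Good γ η' t') γ (res α η).bit =
          lev (P.Good γ) γ η := by
        ext s
        refine exists_congr fun t' => and_congr_left fun _ => ?_
        refine (exists_prop_of_true (show γ < α from hγα)).trans ?_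
        exact P.good_congr_left fun i hi => bit_res (hi.trans hγα)
      rw [this]
    · refine forall₂_congr fun i hi => ?_
      rw [bit_res hi, res_eq_res.2 fun i hi => bit_res (hi.trans (hcl.subset hε))]
      rw [P.path_congr (C' := P.C α) (G' := P.Good) (α := α) (fun j hj => ⟨rfl, rfl, ?_⟩) _ _ hi]
      · rw [P.path_good_congr (hcl.nx_spec hi).2 fun j hj => bit_res (hj.trans (hcl.nx_lt hi))]
      · funext η' t'
        exact propext (exists_prop_of_true (hcl.nx_lt hj))
  rw [Good, h1, h2]

theorem good_zero (η t : Ordinal.{u} → Bool) : P.Good 0 η t :=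
  (hP.good_iff hP.isSuccLimit_succ_ord.bot_lt).2
    ⟨fun _ hγ => absurd hγ not_lt_zero, fun h => h.1.ne_bot rfl⟩

theorem good_add_one {α : Ordinal.{u}} (hα : α < (Order.succ P.lam).ord)
    {η t : Ordinal.{u} → Bool} (h : P.Good α η t) : P.Good (α + 1) η t :=
  (hP.good_iff (hP.isSuccLimit_succ_ord.succ_lt hα)).2
    ⟨fun _ hγ => h.mono (Order.lt_add_one_iff.1 hγ), fun h => Order.not_isSuccLimit_succ α h.1⟩

theorem path_coherent {α δ : Ordinal.{u}} (hα : α < (Order.succ P.lam).ord)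
    (hlim : Order.IsSuccLimit α) (hδ : δ < α) (hδ' : LimPt (P.C α) δ)
    (h : P.C δ = P.C α ∩ Iio δ) (η : Ordinal.{u} → Bool) (x : BinSeq.{u}) {i : Ordinal.{u}}
    (hi : i < δ) : P.path P.Good (P.C δ) η x i = P.path P.Good (P.C α) η x i := by
  have hcl := hP.ladder.club α hα hlim
  have hclδ := hP.ladder.club δ (hδ.trans hα) hδ'.isSuccLimit
  refine P.path_congr (α := δ) (fun j hj => ?_) η x hi
  have h1 : nx (P.C δ) j = nx (P.C α) j := by
    apply le_antisymm
    · obtain ⟨β, h1, h2, h3⟩ := hδ'.2 j hj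
      have h4 := hcl.nx_spec (hj.trans hδ)
      refine nx_le ?_ h4.2
      rw [h]
      exact ⟨h4.1, (nx_le h1 h2).trans_lt h3⟩
    · have h4 := hclδ.nx_spec hj
      exact nx_le (h ▸ h4.1 : _ ∈ P.C α ∩ Iio δ).1 h4.2
  refine ⟨h1, ?_, by rw [h1]⟩
  rw [pv, pv, h, inter_assoc, show Iio δ ∩ Iic j = Iic j from
    inter_eq_right.2 fun x hx => lt_of_le_of_lt hx hj]

/-- If `t` were noncanonical, it would depart from the walk started at each `ε ∈ C α` at some place
`d ε < α`. Guess `t` at a `δ` below which these departures already occur cofinally: then `t` is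
noncanonical at `δ` as well and was removed there. -/
theorem eq_path_of_good {α : Ordinal.{u}} (hα : α < (Order.succ P.lam).ord)
    (hcof : α.cof = P.lam) {η t : Ordinal.{u} → Bool} (ht : P.Good α η t) :
    ∃ ε ∈ P.C α, ∀ i < α, t i = P.path P.Good (P.C α) η (res ε t) i := by
  by_contra! hcon
  have hlim := isSuccLimit_of_cof_eq hP.uncountable hcof
  have hcl := hP.ladder.club α hα hlim
  have : ∀ ε, ∃ i < α, ε ∈ P.C α → t i ≠ P.path P.Good (P.C α) η (res ε t) i := fun ε => by
    by_cases hε : ε ∈ P.C α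
    · obtain ⟨i, hi, hne⟩ := hcon ε hε
      exact ⟨i, hi, fun _ => hne⟩
    · exact ⟨0, hlim.bot_lt, fun h => absurd h hε⟩
  choose d hd hd' using this
  -- Closure is only promised at points of `D δ`, while departures are indexed by `C α`; hence the
  -- passage to `nx (C α) γ`, which also makes `δ` a limit point of `C α`.
  obtain ⟨δ, h1, h2, h3, h4⟩ := hP.guess α hα hcof
    (fun γ => code P.lam (lev (P.Good γ) γ η) (res γ t)) (fun γ => max (nx (P.C α) γ) (d (nx (P.C α) γ)))
    (fun γ _ => code_lt hP.lam_pos _ _) (fun γ hγ => max_lt (hcl.nx_lt hγ) (hd _))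
  have hD := (hP.subset_D δ (h1.trans hα) h2)
  have hnx : ∀ γ < δ, ∃ γ' ∈ P.D δ, γ < γ' ∧ nx (P.C α) γ' ∈ P.C α ∧ γ' < nx (P.C α) γ' ∧
      nx (P.C α) γ' < δ ∧ d (nx (P.C α) γ') < δ := by
    intro γ hγ
    obtain ⟨γ', h5, h6, h7⟩ := hD.2.2 γ hγ
    have h8 := hcl.nx_spec (h7.trans h1)
    have h9 := (h4 γ' h5).1
    exact ⟨γ', h5, h6, h8.1, h8.2, (le_max_left _ _).trans_lt h9, (le_max_right _ _).trans_lt h9⟩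
  have hδlim : LimPt (P.C α) δ := ⟨h2.bot_lt, fun γ hγ =>
    let ⟨γ', _, h6, h7, h8, h9, _⟩ := hnx γ hγ
    ⟨_, h7, h6.trans h8, h9⟩⟩
  have hCδ := hP.ladder.coherent α hα hcof δ h1 hδlim
  have hnk := ((hP.good_iff (h1.trans hα)).1 (ht.mono h1.le)).2
  have : ∃ ε ∈ P.C δ, ∀ i < δ, t i = P.path P.Good (P.C δ) η (res ε t) i := by
    by_contra hne
    exact hnk ⟨h2, h3, fun γ hγ => (h4 γ hγ).2, hne⟩
  obtain ⟨ε, hε, hε'⟩ := this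
  have hεδ : ε < δ := (hCδ ▸ hε : ε ∈ P.C α ∩ Iio δ).2
  obtain ⟨γ', h5, h6, h7, h8, h9, h10⟩ := hnx ε hεδ
  have h11 := P.eq_path_res _ hε' (h6.trans h8).le h9.le _ h10
  rw [hP.path_coherent hα hlim h1 hδlim hCδ η _ h10] at h11
  exact hd' _ h7 h11

end Valid
end TreeData

theorem mk_le_of_res {α : Ordinal.{u}} {S : Set BinSeq.{u}} (hS : ∀ s ∈ S, s.len = α)
    {X : Type (u + 1)} (f : (Ordinal.{u} → Bool) → X)
    (hf : ∀ s ∈ S, ∀ s' ∈ S, f s.bit = f s'.bit → ∀ i < α, s.bit i = s'.bit i) : #S ≤ #X := by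
  refine mk_le_of_injective (f := fun s : S => f s.1.bit) fun s s' h => Subtype.ext ?_
  have := res_eq_res.2 (hf s s.2 s' s'.2 h)
  have h1 := res_bit s.1
  have h2 := res_bit s'.1
  rw [hS s s.2] at h1
  rw [hS s' s'.2] at h2
  rw [← h1, ← h2, this]

/-! ### Size of levels, uniqueness of the removed branch, normality -/

namespace TreeData

theorem mem_lev {P : TreeData.{u}} {γ : Ordinal.{u}} {η t : Ordinal.{u} → Bool}
    (h : P.Good γ η t) : res γ t ∈ lev (P.Good γ) γ η := ⟨t, h, rfl⟩

theorem good_bit_of_mem_lev {P : TreeData.{u}} {γ : Ordinal.{u}} {η : Ordinal.{u} → Bool}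
    {s : BinSeq.{u}} (h : s ∈ lev (P.Good γ) γ η) : s.len = γ ∧ P.Good γ η s.bit := by
  obtain ⟨t, ht, rfl⟩ := h
  exact ⟨rfl, (P.good_congr_right fun i hi => bit_res hi).2 ht⟩

namespace Valid
variable {P : TreeData.{u}} (hP : P.Valid)
include hP

/-- At limits of cofinality below `λ`, a node is determined by its restrictions to a short club and
`λ^{<λ} = λ` applies. At cofinality `λ` no such count is available, but nodes are canonical, so a
restriction to some `ε < α` determines them. -/
theorem mk_lev_le {α : Ordinal.{u}} (hα : α < (Order.succ P.lam).ord) (η : Ordinal.{u} → Bool) :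
    #(lev (P.Good α) α η) ≤ lift.{u + 1} P.lam := by
  have hinf : ℵ₀ ≤ lift.{u + 1} P.lam := by
    rw [aleph0_le_lift]
    exact hP.uncountable.le
  induction α using WellFoundedLT.induction with
  | ind α ih =>
    have hlen : ∀ s ∈ lev (P.Good α) α η, s.len = α := fun s hs => (good_bit_of_mem_lev hs).1
    rcases Ordinal.zero_or_succ_or_isSuccLimit α with rfl | ⟨β, rfl⟩ | hlim
    · refine (mk_le_of_res hlen (fun _ => PUnit.unit.{u + 2})
        fun _ _ _ _ _ i hi => absurd hi not_lt_zero).trans ?_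
      rw [mk_punit]
      exact one_le_aleph0.trans hinf
    · have hβ : β < Order.succ β := Order.lt_succ β
      refine (mk_le_of_injective (f := fun s : lev (P.Good (Order.succ β)) (Order.succ β) η =>
        ((⟨res β s.1.bit, mem_lev ((good_bit_of_mem_lev s.2).2.mono hβ.le)⟩ :
          lev (P.Good β) β η), s.1.bit β)) ?_).trans ?_
      · intro s s' h
        have h1 := congrArg (fun x => x.1.1) h
        have h2 := congrArg (fun x => x.2) h
        simp only at h1 h2
        rw [res_eq_res] at h1
        apply Subtype.ext
        rw [← res_bit s.1, ← res_bit s'.1, hlen s s.2, hlen s' s'.2, res_eq_res]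
        intro i hi
        rcases (Order.lt_succ_iff.1 hi).lt_or_eq with hi | rfl
        · exact h1 i hi
        · exact h2
      · rw [mk_prod, lift_uzero, mk_bool]
        refine (mul_le_mul' (ih β hβ (hβ.trans hα)) (le_refl _)).trans ?_
        refine (mul_le_mul' (le_refl _) ?_).trans (mul_eq_self hinf).le
        exact (by simp : lift.{u + 1} (2 : Cardinal.{0}) ≤ ℵ₀).trans hinf
    · have hle : α.cof ≤ P.lam :=
        (Ordinal.cof_le_card α).trans (Order.lt_succ_iff.1 (lt_ord.1 hα))
      rcases hle.lt_or_eq with hcof | hcof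
      · obtain ⟨E, hE, hE'⟩ := exists_isClubIn hlim
        refine (mk_le_of_injective (f := fun (s : lev (P.Good α) α η) (γ : E) =>
          (⟨res γ s.1.bit, mem_lev ((good_bit_of_mem_lev s.2).2.mono (hE.subset γ.2).le)⟩ :
            lev (P.Good γ) γ.1 η)) ?_).trans ?_
        · intro s s' h
          apply Subtype.ext
          rw [← res_bit s.1, ← res_bit s'.1, hlen s s.2, hlen s' s'.2, res_eq_res]
          intro i hi
          obtain ⟨ε, h1, h2, -⟩ := hE.exists_ge hi
          have := congrArg Subtype.val (congrFun h ⟨ε, h1⟩)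
          exact res_eq_res.1 this i h2
        · rw [mk_pi]
          refine (prod_le_prod _ (fun _ : E => lift.{u + 1} P.lam) fun γ : E =>
            ih γ (hE.subset γ.2) ((hE.subset γ.2).trans hα)).trans ?_
          rw [prod_const']
          refine (power_le_power_left (hinf.trans_lt' aleph0_pos).ne' hE').trans ?_
          rw [← lift_power, lift_le]
          exact hP.power_le _ hcof
      · refine (mk_le_of_injective (β := Σ ε : Iio α, lev (P.Good ε.1) ε.1 η)
          (f := fun s => ⟨⟨(hP.eq_path_of_good hα hcof (good_bit_of_mem_lev s.2).2).choose,
            (hP.ladder.club α hα hlim).subset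
              (hP.eq_path_of_good hα hcof (good_bit_of_mem_lev s.2).2).choose_spec.1⟩,
            res _ s.1.bit, mem_lev ((good_bit_of_mem_lev s.2).2.mono
              ((hP.ladder.club α hα hlim).subset
              (hP.eq_path_of_good hα hcof (good_bit_of_mem_lev s.2).2).choose_spec.1).le)⟩)
          ?_).trans ?_
        · intro s s' h
          have h1 := (hP.eq_path_of_good hα hcof (good_bit_of_mem_lev s.2).2).choose_spec.2
          have h2 := (hP.eq_path_of_good hα hcof (good_bit_of_mem_lev s'.2).2).choose_spec.2
          have h3 := congrArg (fun x => x.2.1) h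
          simp only at h3
          apply Subtype.ext
          rw [← res_bit s.1, ← res_bit s'.1, hlen s s.2, hlen s' s'.2, res_eq_res]
          intro i hi
          rw [h1 i hi, h2 i hi, h3]
        · rw [mk_sigma]
          refine (sum_le_sum _ (fun _ : Iio α => lift.{u + 1} P.lam) fun γ : Iio α =>
            ih γ γ.2 (γ.2.trans hα)).trans ?_
          rw [sum_const', mk_Iio_ordinal]
          refine (mul_le_mul' (lift_le.2 ?_) (le_refl _)).trans (mul_eq_self hinf).le
          exact Order.lt_succ_iff.1 (lt_ord.1 hα)

/-- Both branches have the codes `F α` along the cofinal set `D α`, and the coding is injective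
because levels have size at most `λ`. -/
theorem kill_unique {α : Ordinal.{u}} (hα : α < (Order.succ P.lam).ord)
    {η t t' : Ordinal.{u} → Bool} (ht : P.Kill P.Good α η t) (ht' : P.Kill P.Good α η t')
    (h : ∀ γ < α, P.Good γ η t) (h' : ∀ γ < α, P.Good γ η t') {i : Ordinal.{u}} (hi : i < α) :
    t i = t' i := by
  obtain ⟨γ, h1, h2, h3⟩ := (hP.subset_D α hα ht.1).2.2 i hi
  have := code_injOn hP.lam_pos (hP.mk_lev_le (h3.trans hα) η) (mem_lev (h γ h3))
    (mem_lev (h' γ h3)) ((ht.2.2.1 γ h1).trans (ht'.2.2.1 γ h1).symm)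
  exact res_eq_res.1 this i h2

/-- Along a club, the canonical branch through a node stays in the tree unless it is removed at a
limit point of the club. -/
theorem good_path_or_kill {α : Ordinal.{u}} (hα : α < (Order.succ P.lam).ord)
    {C : Set Ordinal.{u}} (hC : IsClubIn α C) {η t : Ordinal.{u} → Bool}
    (hN : ∀ β < α, ∀ γ < β, ∀ t, P.Good γ η t → ∃ t', P.Good β η t' ∧ ∀ i < γ, t' i = t i)
    {ε : Ordinal.{u}} (hε : ε ∈ C) (ht : P.Good ε η t) :
    P.Good α η (P.path P.Good C η (res ε t)) ∨ ∃ δ ≤ α, ε < δ ∧ LimPt C δ ∧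
      (∀ γ < δ, P.Good γ η (P.path P.Good C η (res ε t))) ∧
        P.Kill P.Good δ η (P.path P.Good C η (res ε t)) := by
  set p := P.path P.Good C η (res ε t) with hp
  have hpε : ∀ i < ε, p i = t i := fun i hi => by
    rw [hp, path_of_lt _ _ (by exact hi), bit_res hi]
  have hgε : P.Good ε η p := (P.good_congr_right hpε).2 ht
  by_cases hgood : P.Good α η p
  · exact Or.inl hgood
  right
  have hmem := csInf_mem (s := {β | ¬ P.Good β η p}) ⟨α, hgood⟩
  set β := sInf {β | ¬ P.Good β η p} with hβ
  have hmin : ∀ γ < β, P.Good γ η p := fun γ hγ => by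
    by_contra h
    exact (csInf_le' h).not_gt hγ
  have hβα : β ≤ α := csInf_le' hgood
  have hεβ : ε < β := by
    by_contra! h
    exact hmem (hgε.mono h)
  have hkill : P.Kill P.Good β η p := by
    by_contra h
    exact hmem ((hP.good_iff (hβα.trans_lt hα)).2 ⟨hmin, h⟩)
  refine ⟨β, hβα, hεβ, ?_, hmin, hkill⟩
  -- If `β` is not a limit point of `C`, it falls within a single step of the walk; that step ends
  -- at a node of length `nx C i₀ ≥ β`, supplied by normality below `α`, so the walk is still in the
  -- tree at `β`.
  by_contra hlp
  have hβα' : β < α := hβα.lt_of_ne fun h => hlp (h ▸ hC.limPt)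
  obtain ⟨γ₀, hγ₀, hγ₀'⟩ : ∃ γ < β, ∀ c ∈ C, γ < c → β ≤ c := by
    by_contra! h
    exact hlp ⟨zero_le.trans_lt hεβ, h⟩
  set i₀ := max γ₀ ε with hi₀
  have hi₀β : i₀ < β := max_lt hγ₀ hεβ
  have hi₀α := hi₀β.trans hβα'
  set σ := pv C i₀
  set γ := nx C i₀
  have hσ : σ ≤ i₀ := pv_le C i₀
  have hεσ : ε ≤ σ := le_pv hε (le_max_right _ _)
  obtain ⟨hγC, hiγ⟩ := hC.nx_spec hi₀α
  have hγα : γ < α := hC.subset hγC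
  have hβγ : β ≤ γ := hγ₀' γ hγC ((le_max_left _ _).trans_lt hiγ)
  obtain ⟨z, hz, hz'⟩ := hN γ hγα σ (hσ.trans_lt hiγ) p (hmin σ (hσ.trans_lt hi₀β))
  obtain ⟨h1, h2⟩ := extend_spec (p := P.Good γ η)
    (z := P.sealing (P.Good γ) γ σ (fun η x => (res σ (P.path P.Good C η x)).bit) (res γ η))
    (y := (res σ p).bit) ⟨z, hz, fun i hi => (hz' i hi).trans (bit_res hi).symm⟩
  refine hmem (((P.good_congr_right fun i hi => ?_).2 h1).mono hβγ)
  rcases lt_or_ge i σ with h3 | h3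
  · rw [h2 i h3, bit_res h3]
  · obtain ⟨h4, h5⟩ := hC.block hε (le_max_right γ₀ ε) hi₀α h3 hi
    rw [hp, path_of_le _ _ (hεσ.trans h3), step, h4, h5]

/-- Fix an extension `y` of length `γ + λ`; the `ν`-th node follows `y` up to `γ + ν`, flips the bit
there and is then extended to `ε`. -/
theorem exists_many_extensions {γ ε : Ordinal.{u}} (hε : ε < (Order.succ P.lam).ord)
    (hγε : γ + P.lam.ord < ε) {η t : Ordinal.{u} → Bool}
    (hN : ∀ β ≤ ε, ∀ γ < β, ∀ t, P.Good γ η t → ∃ t', P.Good β η t' ∧ ∀ i < γ, t' i = t i)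
    (ht : P.Good γ η t) :
    ∃ f : Iio P.lam.ord → Ordinal.{u} → Bool, (∀ ν, P.Good ε η (f ν) ∧ ∀ i < γ, f ν i = t i) ∧
      ∀ ν ν', ν < ν' → ∃ i < ε, f ν i ≠ f ν' i := by
  classical
  obtain ⟨y, hy, hyt⟩ := hN _ hγε.le γ
    (lt_add_of_pos_right γ (ord_pos.2 hP.lam_pos)) t ht
  have key : ∀ ν : Iio P.lam.ord, ∃ f, P.Good ε η f ∧ (∀ i < γ + ν, f i = y i) ∧
      f (γ + ν) = !y (γ + ν) := by
    intro ν
    have h1 : γ + ν.1 < γ + P.lam.ord := (add_lt_add_iff_left γ).2 ν.2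
    have h2 : P.Good (γ + ν.1) η (Function.update y (γ + ν.1) (!y (γ + ν.1))) :=
      (P.good_congr_right fun i hi => Function.update_of_ne hi.ne _ _).2 (hy.mono h1.le)
    obtain ⟨f, hf, hf'⟩ := hN ε le_rfl (γ + ν.1 + 1)
      ((Order.add_one_le_of_lt h1).trans_lt hγε) _
      (hP.good_add_one ((h1.trans hγε).trans hε) h2)
    refine ⟨f, hf, fun i hi => ?_, ?_⟩
    · rw [hf' i (hi.trans (lt_add_one _)), Function.update_of_ne hi.ne]
    · rw [hf' _ (lt_add_one _), Function.update_self]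
  choose f hf hf' hf'' using key
  refine ⟨f, fun ν => ⟨hf ν, fun i hi => ?_⟩, fun ν ν' h => ⟨γ + ν, ?_, ?_⟩⟩
  · rw [hf' ν i (hi.trans_le (le_self_add)), hyt i hi]
  · exact ((add_lt_add_iff_left γ).2 (mem_Iio.1 ν.2)).trans hγε
  · rw [hf'' ν, hf' ν' _ ((add_lt_add_iff_left γ).2 h)]
    simp

/-- At a coherent limit, the walk along `C β` is canonical at every limit point of `C β`, hence
never removed. At the other limits, start `λ` distinct walks along a club `E` of size below `λ`. If
all failed, they would be removed at points of `E ∪ {β}`, at different points by uniqueness of the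
removed branch; there are too few points. -/
theorem exists_good_extension {β : Ordinal.{u}} (hβ : β < (Order.succ P.lam).ord)
    {γ : Ordinal.{u}} (hγ : γ < β) {η t : Ordinal.{u} → Bool} (ht : P.Good γ η t) :
    ∃ t', P.Good β η t' ∧ ∀ i < γ, t' i = t i := by
  induction β using WellFoundedLT.induction generalizing γ t with
  | ind β ih =>
    have hN : ∀ β' < β, ∀ γ < β', ∀ t, P.Good γ η t → ∃ t', P.Good β' η t' ∧ ∀ i < γ, t' i = t i :=
      fun β' h1 γ h2 t h3 => ih β' h1 (h1.trans hβ) h2 h3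
    rcases Ordinal.zero_or_succ_or_isSuccLimit β with rfl | ⟨β, rfl⟩ | hlim
    · exact absurd hγ not_lt_zero
    · have hβ' : β < Order.succ β := Order.lt_succ β
      rcases (Order.lt_succ_iff.1 hγ).lt_or_eq with h | rfl
      · obtain ⟨t', h1, h2⟩ := hN β hβ' γ h t ht
        exact ⟨t', hP.good_add_one (hβ'.trans hβ) h1, h2⟩
      · exact ⟨t, hP.good_add_one (hβ'.trans hβ) ht, fun _ _ => rfl⟩
    · have hcl := hP.ladder.club β hβ hlim
      rcases hP.ladder.coherent_or β hβ hlim with hcoh | ⟨hcof, hadd⟩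
      · obtain ⟨ε, hε, hγε, hεβ⟩ := hcl.exists_ge hγ
        obtain ⟨t', ht', htt'⟩ := hN ε hεβ γ hγε t ht
        have hp : ∀ i < ε, P.path P.Good (P.C β) η (res ε t') i = t' i := fun i hi => by
          rw [path_of_lt _ _ (by exact hi), bit_res hi]
        rcases hP.good_path_or_kill hβ hcl hN hε ht' with h | ⟨δ, h1, h2, h3, -, h5⟩
        · exact ⟨_, h, fun i hi => (hp i (hi.trans hγε)).trans (htt' i hi)⟩
        · refine absurd ?_ h5.2.2.2
          refine ⟨ε, ?_, fun i hi => ?_⟩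
          · rcases h1.lt_or_eq with h1 | rfl
            · rw [hcoh δ h1 h3]
              exact ⟨hε, h2⟩
            · exact hε
          · rw [res_eq_res.2 hp]
            rcases h1.lt_or_eq with h1 | rfl
            · rw [hP.path_coherent hβ hlim h1 h3 (hcoh δ h1 h3) η _ hi]
            · rfl
      · obtain ⟨E, hE, hE'⟩ := exists_isClubIn hlim
        obtain ⟨ε, hε, hγε, hεβ⟩ := hE.exists_ge (hadd γ hγ)
        obtain ⟨f, hf, hf'⟩ := hP.exists_many_extensions (hεβ.trans hβ) hγε
          (fun β' hβ' => hN β' (hβ'.trans_lt hεβ)) ht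
        have hp : ∀ ν, ∀ i < ε, P.path P.Good E η (res ε (f ν)) i = f ν i := fun ν i hi => by
          rw [path_of_lt _ _ (by exact hi), bit_res hi]
        by_cases hex : ∃ ν, P.Good β η (P.path P.Good E η (res ε (f ν)))
        · obtain ⟨ν, hν⟩ := hex
          refine ⟨_, hν, fun i hi => ?_⟩
          rw [hp ν i (hi.trans (lt_of_le_of_lt le_self_add hγε)), (hf ν).2 i hi]
        · exfalso
          have hk := fun ν => (hP.good_path_or_kill hβ hE hN hε (hf ν).1).resolve_left
            fun h => hex ⟨ν, h⟩
          choose δ h1 h2 h3 h4 h5 using hk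
          have hδE : ∀ ν, δ ν ∈ insert β E := fun ν => (h1 ν).lt_or_eq.elim
            (fun h => Or.inr (hE.closed _ h (h3 ν))) Or.inl
          have hinj : ∀ ν ν', ν < ν' → δ ν ≠ δ ν' := by
            intro ν ν' hlt heq
            obtain ⟨i, hi, hne⟩ := hf' ν ν' hlt
            refine hne ?_
            have hkk := h5 ν'
            have hgg := h4 ν'
            rw [← heq] at hkk hgg
            rw [← hp ν i hi, ← hp ν' i hi]
            exact hP.kill_unique ((h1 ν).trans_lt hβ) (h5 ν) hkk (h4 ν) hgg (hi.trans (h2 ν))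
          have hcard : #(Iio P.lam.ord) ≤ #(insert β E : Set Ordinal.{u}) :=
            mk_le_of_injective (f := fun ν => (⟨δ ν, hδE ν⟩ : (insert β E : Set Ordinal.{u})))
              fun ν ν' h => by
                have h := congrArg Subtype.val h
                by_contra hne
                rcases lt_or_gt_of_ne hne with hlt | hlt
                · exact hinj _ _ hlt h
                · exact hinj _ _ hlt h.symm
          rw [mk_Iio_ordinal, card_ord] at hcard
          have hinf : ℵ₀ ≤ lift.{u + 1} P.lam := by
            rw [aleph0_le_lift]
            exact hP.uncountable.le
          refine hcard.not_gt (mk_insert_le.trans_lt ?_)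
          exact add_lt_of_lt hinf (hE'.trans_lt (lift_lt.2 hcof)) (one_lt_aleph0.trans_le hinf)

end Valid
end TreeData

/-! ### Counting nodes and tuples of nodes -/

theorem mk_binSeq_le {lam : Cardinal.{u}} (hlam : ℵ₀ ≤ lam) (hpow : Order.succ lam = 2 ^ lam) :
    #{s : BinSeq.{u} // s.len < (Order.succ lam).ord} ≤ lift.{u + 1} (2 ^ lam) := by
  have h1 : #{s : BinSeq.{u} // s.len < (Order.succ lam).ord} ≤
      #(Σ γ : Iio (Order.succ lam).ord, (Iio γ.1 → Bool)) := by
    refine mk_le_of_injective (f := fun s => ⟨⟨s.1.len, s.2⟩, s.1.val⟩) ?_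
    rintro ⟨⟨a, f⟩, ha⟩ ⟨⟨b, g⟩, hb⟩ h
    obtain rfl : a = b := congrArg (fun x => x.1.1) h
    obtain rfl : f = g := eq_of_heq (Sigma.mk.inj h).2
    rfl
  refine h1.trans ?_
  rw [mk_sigma]
  refine (sum_le_sum _ (fun _ : Iio (Order.succ lam).ord => lift.{u + 1} (2 ^ lam))
    fun γ : Iio (Order.succ lam).ord => ?_).trans ?_
  · have hγ : γ.1.card ≤ lam := Order.lt_succ_iff.1 (lt_ord.1 γ.2)
    have : #(Iio γ.1 → Bool) = lift.{u + 1} (2 ^ γ.1.card) := by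
      simp [mk_Iio_ordinal]
    rw [this, lift_le]
    exact power_le_power_left two_ne_zero hγ
  · rw [sum_const', mk_Iio_ordinal, card_ord, ← hpow, mul_eq_self]
    rw [aleph0_le_lift]
    exact hlam.trans (Order.le_succ lam)

theorem exists_enumeration_of_tuples {lam : Cardinal.{u}} (hlam : ℵ₀ ≤ lam)
    (hpow : Order.succ lam = 2 ^ lam) {I : Type (u + 1)} (hI : #I ≤ lift.{u + 1} lam) :
    ∃ q : Ordinal.{u} → I → BinSeq.{u}, (∀ o i, (q o i).len < (Order.succ lam).ord) ∧
      ∀ f : I → BinSeq.{u}, (∀ i, (f i).len < (Order.succ lam).ord) →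
        ∃ o < (Order.succ lam).ord, q o = f := by
  let N := {s : BinSeq.{u} // s.len < (Order.succ lam).ord}
  have hpos : 0 < (Order.succ lam).ord := ord_pos.2 (Order.bot_lt_succ lam)
  have hN : Nonempty N := ⟨⟨res 0 fun _ => false, hpos⟩⟩
  have h1 : #(I → N) ≤ #(Iio (Order.succ lam).ord) := by
    rw [← power_def, mk_Iio_ordinal, card_ord]
    refine (power_le_power_right (mk_binSeq_le hlam hpow)).trans ?_
    refine (power_le_power_left ?_ hI).trans ?_
    · rw [← hpow, Ne, lift_eq_zero]
      exact (Order.bot_lt_succ lam).ne'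
    · rw [← lift_power, ← power_mul, mul_eq_self hlam, hpow]
  obtain ⟨q, hq⟩ := exists_surjective_of_mk_le h1
  classical
  refine ⟨fun o i => if ho : o ∈ Iio (Order.succ lam).ord then (q ⟨o, ho⟩ i).1
    else (q ⟨0, hpos⟩ i).1, fun o i => ?_, fun f hf => ?_⟩
  · by_cases ho : o ∈ Iio (Order.succ lam).ord
    · simp only [dif_pos ho]
      exact (q ⟨o, ho⟩ i).2
    · simp only [dif_neg ho]
      exact (q ⟨0, hpos⟩ i).2
  · obtain ⟨o, ho⟩ := hq fun i => ⟨f i, hf i⟩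
    refine ⟨o, o.2, funext fun i => ?_⟩
    simp only [dif_pos o.2, Subtype.coe_eta, ho]

/-! ### Sealing dense sets of tuples -/

namespace TreeData

/-- The guessing hypotheses needed to seal antichains. -/
structure Sealing (P : TreeData.{u}) : Prop extends P.Valid where
  succ_eq : Order.succ P.lam = 2 ^ P.lam
  guess_tuples : ∀ G : Ordinal.{u} → Iio P.lam.ord → BinSeq.{u} × BinSeq.{u} × BinSeq.{u},
    (∀ γ < (Order.succ P.lam).ord, ∀ j, (G γ j).1.len < (Order.succ P.lam).ord ∧
      (G γ j).2.1.len < (Order.succ P.lam).ord ∧ (G γ j).2.2.len < (Order.succ P.lam).ord) →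
    ∀ d : Ordinal.{u} → Ordinal.{u},
      (∀ γ < (Order.succ P.lam).ord, d γ < (Order.succ P.lam).ord) →
      ∃ β < (Order.succ P.lam).ord, 0 < β ∧ (∀ γ < β, d γ < β) ∧ ∀ γ < β, G γ = P.Ω β γ
  hit : ∀ B : Ordinal.{u} → Set Ordinal.{u},
    (∀ i < (Order.succ P.lam).ord, ∀ γ < (Order.succ P.lam).ord,
      ∃ β ∈ B i, γ < β ∧ β < (Order.succ P.lam).ord ∧ P.lam.ord * β = β) →
    ∀ d : Ordinal.{u} → Ordinal.{u},
      (∀ γ < (Order.succ P.lam).ord, d γ < (Order.succ P.lam).ord) →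
      ∃ α < (Order.succ P.lam).ord, α.cof = P.lam ∧ (∀ γ < α, d γ < α) ∧
        ∀ i < α, ∀ γ < α, ∃ β ∈ B i, β ∈ P.C α ∧ γ < β ∧ ¬ LimPt (P.C α) β

variable {P : TreeData.{u}}

theorem Valid.mk_tuples_lt (hP : P.Valid) {I : Type (u + 1)} (hI : #I < lift.{u + 1} P.lam)
    (η : I → Ordinal.{u} → Bool) {σ : Ordinal.{u}} (hσ : σ < (Order.succ P.lam).ord) :
    #(∀ i, lev (P.Good σ) σ (η i)) < lift.{u + 1} (Order.succ P.lam) := by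
  rw [mk_pi]
  refine (prod_le_prod _ (fun _ : I => lift.{u + 1} P.lam) fun i : I =>
    hP.mk_lev_le hσ (η i)).trans_lt ?_
  rw [prod_const']
  obtain ⟨c, hc⟩ := mem_range_lift_of_le hI.le
  rw [← hc, lift_lt] at hI
  rw [← hc, ← lift_power, lift_lt, Order.lt_succ_iff]
  exact hP.power_le c hI

/-- At most `λ` tuples live on level `σ`, so regularity of `λ⁺` bounds the witnesses. Nodes are
represented by total functions, hence the invariance hypothesis on `Q`. -/
theorem Valid.exists_bound_of_tuples (hP : P.Valid) {I : Type (u + 1)}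
    (hI : #I < lift.{u + 1} P.lam) (η : I → Ordinal.{u} → Bool) {σ : Ordinal.{u}}
    (hσ : σ < (Order.succ P.lam).ord) (Q : (I → Ordinal.{u} → Bool) → Ordinal.{u} → Prop)
    (hQ : ∀ y y', (∀ i, ∀ k < σ, y i k = y' i k) → ∀ o, Q y o → Q y' o)
    (h : ∀ y, (∀ i, P.Good σ (η i) (y i)) → ∃ o < (Order.succ P.lam).ord, Q y o) :
    ∃ ρ < (Order.succ P.lam).ord, ∀ y, (∀ i, P.Good σ (η i) (y i)) → ∃ o < ρ, Q y o := by
  choose f hf hf' using fun p : ∀ i, lev (P.Good σ) σ (η i) =>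
    h (fun i => (p i).1.bit) fun i => (good_bit_of_mem_lev (p i).2).2
  have hreg : (Order.succ P.lam).IsRegular := isRegular_succ hP.uncountable.le
  obtain ⟨ρ, hρ, hρ'⟩ := exists_lt_of_family (a := (Order.succ P.lam).ord) f
    (by rw [hreg.cof_ord]; exact hP.mk_tuples_lt hI η hσ) hf
  refine ⟨ρ, hρ, fun y hy => ⟨_, hρ' fun i => ⟨res σ (y i), mem_lev (hy i)⟩, ?_⟩⟩
  exact hQ _ y (fun i k hk => bit_res hk) _ (hf' fun i => ⟨res σ (y i), mem_lev (hy i)⟩)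

/-- Every dense family of tuples of nodes is met, below some level `α`, by every tuple of nodes of
length `α`. -/
theorem Sealing.exists_sealed_level (hS : P.Sealing) {I : Type (u + 1)} [Nonempty I]
    (hI : #I < lift.{u + 1} P.lam) {η : I → Ordinal.{u} → Bool}
    (hη : ∀ i i', i ≠ i' → ∃ γ < (Order.succ P.lam).ord, η i γ ≠ η i' γ)
    {A : Set (I → BinSeq.{u})} (hlen : ∀ a ∈ A, ∀ i i', (a i).len = (a i').len)
    (hA : ∀ γ < (Order.succ P.lam).ord, ∀ y : I → Ordinal.{u} → Bool,
      (∀ i, P.Good γ (η i) (y i)) → ∃ γ' < (Order.succ P.lam).ord, γ ≤ γ' ∧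
        ∃ y' : I → Ordinal.{u} → Bool, (∀ i, P.Good γ' (η i) (y' i)) ∧
          (∀ i, ∀ k < γ, y' i k = y i k) ∧ (fun i => res γ' (y' i)) ∈ A) :
    ∃ α < (Order.succ P.lam).ord, ∀ s : I → Ordinal.{u} → Bool,
      (∀ i, P.Good α (η i) (s i)) → ∃ γ < α, (fun i => res γ (s i)) ∈ A := by
  classical
  have hP := hS.toValid
  set κ := Order.succ P.lam with hκ
  have hreg : κ.IsRegular := isRegular_succ hP.uncountable.le
  have hlimκ : Order.IsSuccLimit κ.ord := hP.isSuccLimit_succ_ord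
  have hpos := ord_pos.2 hP.lam_pos
  have hIκ : #I < lift.{u + 1} κ := hI.trans (lift_lt.2 (Order.lt_succ _))
  have hmul : ∀ γ < κ.ord, P.lam.ord * γ < κ.ord := by
    intro γ hγ
    rw [lt_ord, Ordinal.card_mul, card_ord, Order.lt_succ_iff]
    exact (mul_le_mul_right (Order.lt_succ_iff.1 (lt_ord.1 hγ)) _).trans
      (mul_eq_self hP.uncountable.le).le
  obtain ⟨q, hq, hq'⟩ := exists_enumeration_of_tuples hP.uncountable.le hS.succ_eq hI.le
  -- Guesses are indexed by `λ`; `π` lists `I` with repetitions.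
  obtain ⟨π, hπ⟩ : ∃ π : Iio P.lam.ord → I, Function.Surjective π :=
    exists_surjective_of_mk_le (by rw [mk_Iio_ordinal, card_ord]; exact hI.le)
  obtain ⟨a₀, ha₀, ha₀'⟩ : ∃ a ∈ A, ∀ i, (a i).len < κ.ord := by
    obtain ⟨γ', h1, -, y', -, -, h2⟩ := hA 0 hlimκ.bot_lt (fun _ _ => false)
      fun i => hP.good_zero _ _
    exact ⟨_, h2, fun i => h1⟩
  -- An enumeration of the members of `A` bounded in length; the default `a₀` keeps every entry in
  -- `A`.
  let a : Ordinal.{u} → I → BinSeq.{u} := fun o => if q o ∈ A then q o else a₀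
  have haA : ∀ o, a o ∈ A := fun o => by
    by_cases h : q o ∈ A
    · simpa only [a, if_pos h] using h
    · simpa only [a, if_neg h] using ha₀
  have halen : ∀ o i, (a o i).len < κ.ord := fun o i => by
    by_cases h : q o ∈ A
    · simpa only [a, if_pos h] using hq o i
    · simpa only [a, if_neg h] using ha₀' i
  have hρ₁ : ∀ σ, ∃ ρ, σ < κ.ord → ρ < κ.ord ∧ ∀ y : I → Ordinal.{u} → Bool,
      (∀ i, P.Good σ (η i) (y i)) → ∃ o < ρ, q o = fun i => res σ (y i) := by
    intro σ
    by_cases hσ : σ < κ.ord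
    · obtain ⟨ρ, h1, h2⟩ := hP.exists_bound_of_tuples hI η hσ
        (fun y o => q o = fun i => res σ (y i))
        (fun y y' h o ho => ho.trans (funext fun i => res_eq_res.2 (h i)))
        (fun y _ => hq' _ fun i => hσ)
      exact ⟨ρ, fun _ => ⟨h1, h2⟩⟩
    · exact ⟨0, fun h => absurd h hσ⟩
  choose ρ₁ hρ₁ using hρ₁
  -- Below a closure point of `ρ₂`, every tuple of nodes extends to a member of `A` whose height and
  -- index are both below that point.
  have hρ₂ : ∀ σ, ∃ ρ, σ < κ.ord → ρ < κ.ord ∧ ∀ y : I → Ordinal.{u} → Bool,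
      (∀ i, P.Good σ (η i) (y i)) → ∃ b < ρ, ∃ γ' ≤ b, σ ≤ γ' ∧ ∃ y' : I → Ordinal.{u} → Bool,
        (∀ i, P.Good γ' (η i) (y' i)) ∧ (∀ i, ∀ k < σ, y' i k = y i k) ∧
          ∃ o ≤ b, q o = (fun i => res γ' (y' i)) ∧ q o ∈ A := by
    intro σ
    by_cases hσ : σ < κ.ord
    · obtain ⟨ρ, h1, h2⟩ := hP.exists_bound_of_tuples hI η hσ
        (fun y b => ∃ γ' ≤ b, σ ≤ γ' ∧ ∃ y' : I → Ordinal.{u} → Bool,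
          (∀ i, P.Good γ' (η i) (y' i)) ∧ (∀ i, ∀ k < σ, y' i k = y i k) ∧
            ∃ o ≤ b, q o = (fun i => res γ' (y' i)) ∧ q o ∈ A)
        (fun y y' h b ⟨γ', h1, h2, z, h3, h4, h5⟩ =>
          ⟨γ', h1, h2, z, h3, fun i k hk => (h4 i k hk).trans (h i k hk), h5⟩)
        (fun y hy => by
          obtain ⟨γ', h1, h2, y', h3, h4, h5⟩ := hA σ hσ y hy
          obtain ⟨o, ho, ho'⟩ := hq' (fun i => res γ' (y' i)) fun i => h1
          exact ⟨max γ' o, max_lt h1 ho, γ', le_max_left _ _, h2, y', h3, h4, o, le_max_right _ _,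
            ho', ho' ▸ h5⟩)
      exact ⟨ρ, fun _ => ⟨h1, h2⟩⟩
    · exact ⟨0, fun h => absurd h hσ⟩
  choose ρ₂ hρ₂ using hρ₂
  -- Beyond `γ₀` the restrictions of the `η i` are distinct and can label coordinates.
  obtain ⟨γ₀, hγ₀, hγ₀'⟩ : ∃ γ₀ < κ.ord, ∀ i i', i ≠ i' → ∃ γ < γ₀, η i γ ≠ η i' γ := by
    have : ∀ p : I × I, ∃ γ < κ.ord, p.1 ≠ p.2 → η p.1 γ ≠ η p.2 γ := fun p => by
      by_cases h : p.1 = p.2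
      · exact ⟨0, hlimκ.bot_lt, fun h' => absurd h h'⟩
      · obtain ⟨γ, h1, h2⟩ := hη _ _ h
        exact ⟨γ, h1, fun _ => h2⟩
    choose f hf hf' using this
    have hinf : ℵ₀ ≤ lift.{u + 1} κ := by
      rw [aleph0_le_lift]
      exact hreg.aleph0_le
    obtain ⟨γ₀, h1, h2⟩ := exists_lt_of_family (a := κ.ord) f (by
      rw [hreg.cof_ord, mk_prod, lift_id]
      exact mul_lt_of_lt hinf hIκ hIκ) hf
    exact ⟨γ₀, h1, fun i i' h => ⟨f (i, i'), h2 _, hf' (i, i') h⟩⟩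
  let d : Ordinal.{u} → Ordinal.{u} := fun γ =>
    max (max (ρ₁ γ) (ρ₂ γ)) (max (Order.succ γ) (max (P.lam.ord * γ) γ₀))
  have hd : ∀ γ < κ.ord, d γ < κ.ord := fun γ hγ =>
    max_lt (max_lt (hρ₁ γ hγ).1 (hρ₂ γ hγ).1)
      (max_lt (hlimκ.succ_lt hγ) (max_lt (hmul γ hγ) hγ₀))
  -- What is to be guessed: the parameters, piece by piece; the starting tuple `q o`, the same for
  -- all `γ`; the `γ`-th member of `A`.
  let G : Ordinal.{u} → Ordinal.{u} → Iio P.lam.ord → BinSeq.{u} × BinSeq.{u} × BinSeq.{u} :=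
    fun o γ j => (res γ (η (π j)), q o (π j), a γ (π j))
  -- The `o`-th target set consists of closure points at which the guess for starting tuple `q o` is
  -- right. Thus one `α` serves all starting tuples with index below `α`.
  obtain ⟨α, hα, hcof, hαd, hαhit⟩ := hS.hit
    (fun o => {β | β < κ.ord ∧ 0 < β ∧ (∀ γ < β, d γ < β) ∧ ∀ γ < β, G o γ = P.Ω β γ})
    (fun o ho γ hγ => by
      obtain ⟨β, h1, h2, h3, h4⟩ := hS.guess_tuples (G o)
        (fun γ hγ j => ⟨hγ, hq _ _, halen _ _⟩) (fun ξ => max (d ξ) γ)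
        (fun ξ hξ => max_lt (hd ξ hξ) hγ)
      have h5 : ∀ ξ < β, d ξ < β := fun ξ hξ => (le_max_left _ _).trans_lt (h3 ξ hξ)
      have hlim : Order.IsSuccLimit β := by
        refine ⟨fun h0 => h2.ne (h0.eq_bot).symm, fun ξ hξ => ?_⟩
        exact hξ.2 (Order.lt_succ ξ)
          (((le_max_left _ _).trans (le_max_right _ _)).trans_lt (h5 ξ hξ.lt))
      refine ⟨β, ⟨h1, h2, h5, h4⟩, (le_max_right _ _).trans_lt (h3 0 h2), h1, ?_⟩
      refine le_antisymm ?_ (Ordinal.le_mul_right β hpos)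
      rw [Ordinal.mul_le_iff_of_isSuccLimit hlim]
      exact fun b hb => (((le_max_left _ _).trans ((le_max_right _ _).trans
        (le_max_right _ _))).trans_lt (h5 b hb)).le) d hd
  refine ⟨α, hα, fun s hs => ?_⟩
  have hlim := isSuccLimit_of_cof_eq hP.uncountable hcof
  have hcl := hP.ladder.club α hα hlim
  -- There are fewer than `cof α` coordinates, so all walks may be started from one common `ε`.
  choose ε' hε' hε'' using fun i => hP.eq_path_of_good hα hcof (hs i)
  obtain ⟨ε₀, hε₀, hε₀'⟩ := exists_lt_of_family (a := α) ε' (by rwa [hcof])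
    fun i => hcl.subset (hε' i)
  obtain ⟨ε, hε, hε₀ε, hεα⟩ := hcl.exists_ge hε₀
  have hpath : ∀ i, ∀ k < α, s i k = P.path P.Good (P.C α) (η i) (res ε (s i)) k := fun i =>
    P.eq_path_res _ (hε'' i) ((hε₀' i).trans hε₀ε).le hεα.le
  obtain ⟨o, ho, hqo⟩ := (hρ₁ ε (hεα.trans hα)).2 s fun i => (hs i).mono hεα.le
  have hoα : o < α := ho.trans (((le_max_left _ _).trans (le_max_left _ _)).trans_lt (hαd ε hεα))
  obtain ⟨β, ⟨hβκ, hβ0, hβd, hβG⟩, hβC, hεβ, hβlim⟩ := hαhit o hoα ε hεα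
  have hβα : β < α := hcl.subset hβC
  obtain ⟨γ₁, hγ₁, hγ₁'⟩ : ∃ γ < β, ∀ c ∈ P.C α, γ < c → β ≤ c := by
    by_contra! h
    exact hβlim ⟨hβ0, h⟩
  set i₀ := max γ₁ ε with hi₀
  have hi₀β : i₀ < β := max_lt hγ₁ hεβ
  have hi₀α := hi₀β.trans hβα
  have hnx : nx (P.C α) i₀ = β := le_antisymm (nx_le hβC hi₀β)
    (hγ₁' _ (hcl.nx_spec hi₀α).1 ((le_max_left _ _).trans_lt (hcl.nx_spec hi₀α).2))
  set σ := pv (P.C α) i₀ with hσdef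
  have hεσ : ε ≤ σ := le_pv hε (le_max_right _ _)
  have hσβ : σ < β := (pv_le _ _).trans_lt hi₀β
  have hblock : ∀ k, σ ≤ k → k < β → nx (P.C α) k = β ∧ pv (P.C α) k = σ := fun k h1 h2 => by
    rw [← hnx] at h2
    have := hcl.block hε (le_max_right γ₁ ε) hi₀α h1 h2
    rwa [hnx] at this
  have hβsucc : ∀ γ < β, Order.succ γ < β := fun γ hγ =>
    ((le_max_left _ _).trans (le_max_right _ _)).trans_lt (hβd γ hγ)
  have hγ₀β : γ₀ < β := (((le_max_right _ _).trans (le_max_right _ _)).trans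
    (le_max_right _ _)).trans_lt (hβd 0 hβ0)
  have hinj : ∀ i i', res β (η i) = res β (η i') → i = i' := fun i i' h => by
    by_contra hne
    obtain ⟨γ, h1, h2⟩ := hγ₀' i i' hne
    exact h2 (res_eq_res.1 h γ (h1.trans hγ₀β))
  let Y : (Ordinal.{u} → Bool) → BinSeq.{u} → Ordinal.{u} → Bool :=
    fun η x => (res σ (P.path P.Good (P.C α) η x)).bit
  have hY : ∀ i, ∀ k < σ, Y (η i) (res ε (s i)) k = s i k := fun i k hk =>
    (bit_res hk).trans (hpath i k ((hk.trans hσβ).trans hβα)).symm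
  have hΩ : ∀ γ < β, ∀ j, P.Ω β γ j = (res γ (η (π j)), res ε (s (π j)), a γ (π j)) := by
    intro γ hγ j
    rw [← hβG γ hγ]
    simp only [G, hqo]
  -- The guess being right, a prescription exists: take a member of `A` above the tuple at `σ` and
  -- extend it to length `β` by normality.
  have hex : ∃ Z, P.SealCond (P.Good β) β σ Y Z := by
    obtain ⟨b, hb, γ', h1, h2, y', h3, h4, o', h5, h6, h7⟩ :=
      (hρ₂ σ (hσβ.trans hβκ)).2 s fun i => (hs i).mono (hσβ.trans hβα).le
    have hbβ : b < β := hb.trans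
      (((le_max_right _ _).trans (le_max_left _ _)).trans_lt (hβd σ hσβ))
    choose w hw hw' using fun i =>
      hP.exists_good_extension hβκ (h1.trans_lt hbβ) (h3 i)
    have hZ : ∃ Z : BinSeq.{u} → Ordinal.{u} → Bool, ∀ i, Z (res β (η i)) = w i := by
      refine ⟨fun b => if h : ∃ i, b = res β (η i) then w h.choose else b.bit, fun i => ?_⟩
      have h : ∃ i', res β (η i) = res β (η i') := ⟨i, rfl⟩
      simp only [dif_pos h]
      rw [← hinj _ _ h.choose_spec]
    obtain ⟨Z, hZ⟩ := hZ
    refine ⟨Z, fun j => η (π j), fun j γ hγ => ?_, fun j => ⟨?_, fun k hk => ?_⟩,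
      o', h5.trans_lt hbβ, fun j => ?_⟩
    · rw [hΩ γ hγ]
    · rw [hZ]
      exact hw _
    · rw [hZ, hΩ 0 hβ0, hY _ k hk, hw' _ k (hk.trans_le h2), h4 _ k hk]
    · rw [hZ, hΩ o' (h5.trans_lt hbβ)]
      simp only [a, if_pos h7]
      rw [h6, res_le_res]
      exact ⟨(h1.trans_lt hbβ).le, hw' _⟩
  set Z := P.sealing (P.Good β) β σ Y with hZdef
  have hZspec : P.SealCond (P.Good β) β σ Y Z := by
    rw [hZdef, TreeData.sealing, dif_pos hex]
    exact hex.choose_spec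
  -- The chosen prescription comes with its own parameters `η'`, but the guess forces these to agree
  -- with the true ones below `β`.
  obtain ⟨η', h1, h2, o', ho', h3⟩ := hZspec
  have hagree : ∀ j, ∀ k < β, η' j k = η (π j) k := fun j k hk => by
    have := h1 j _ (hβsucc k hk)
    rw [hΩ _ (hβsucc k hk)] at this
    exact res_eq_res.1 this k (Order.lt_succ k)
  have hres : ∀ j, res β (η' j) = res β (η (π j)) := fun j => res_eq_res.2 (hagree j)
  have hZgood : ∀ i, P.Good β (η i) (Z (res β (η i))) ∧
      ∀ k < σ, Z (res β (η i)) k = s i k := by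
    intro i
    obtain ⟨j, rfl⟩ := hπ i
    obtain ⟨h4, h5⟩ := h2 j
    rw [hres] at h4 h5
    refine ⟨(P.good_congr_left (hagree j)).1 h4, fun k hk => ?_⟩
    rw [h5 k hk, hΩ 0 hβ0, ← hY _ k hk]
    simp only [Y]
    rw [bit_res hk, bit_res hk]
    exact P.path_good_congr (lt_nx_of_lt_pv hk) fun m hm =>
      hagree j m ((hm.trans_le (nx_le_pv hk)).trans hσβ)
  -- `extend` prefers the prescribed node whenever it is in the tree and extends the current one, so
  -- each walk passes through it.
  have hsZ : ∀ i, ∀ k < β, s i k = Z (res β (η i)) k := by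
    intro i k hk
    rcases lt_or_ge k σ with h | h
    · exact ((hZgood i).2 k h).symm
    · obtain ⟨h4, h5⟩ := hblock k h hk
      rw [hpath i k (hk.trans hβα), path_of_le _ _ (hεσ.trans h), step, h4, h5]
      rw [extend_of (hZgood i).1]
      intro m hm
      exact ((hZgood i).2 m hm).trans (hY i m hm).symm
  have hle : ∀ i, a o' i ≤ res β (s i) := by
    intro i
    obtain ⟨j, rfl⟩ := hπ i
    have := h3 j
    rw [hΩ o' ho', hres] at this
    rwa [res_eq_res.2 (hsZ (π j))]
  obtain ⟨i₁⟩ := ‹Nonempty I›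
  refine ⟨(a o' i₁).len, (hle i₁).1.trans_lt hβα, ?_⟩
  have : (fun i => res (a o' i₁).len (s i)) = a o' := by
    funext i
    have h4 := hle i
    rw [← res_bit (a o' i), hlen _ (haA o') i i₁] at h4 ⊢
    exact res_eq_res.2 (res_le_res.1 h4).2
  rw [this]
  exact haA o'

end TreeData

/-! ### Ranked partial orders -/

/-- `h` is the height function of the tree `X`. -/
structure IsRank {X : Type v} [PartialOrder X] (h : X → Ordinal.{u}) : Prop where
  lt : ∀ x y, x < y → h x < h y
  exists_lt : ∀ x, ∀ γ < h x, ∃ y < x, h y = γ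
  trichotomy : ∀ x y z, y < x → z < x → h y ≤ h z → y ≤ z

namespace IsRank
variable {X : Type v} [PartialOrder X] {h : X → Ordinal.{u}} (hh : IsRank h)
include hh

theorem eq_of_lt {x y z : X} (hy : y < x) (hz : z < x) (hyz : h y = h z) : y = z :=
  le_antisymm (hh.trichotomy x y z hy hz hyz.le) (hh.trichotomy x z y hz hy hyz.ge)

theorem le {x y : X} (hxy : x ≤ y) : h x ≤ h y := by
  rcases hxy.lt_or_eq with h' | rfl
  · exact (hh.lt _ _ h').le
  · exact le_rfl

theorem exists_le {x : X} {γ : Ordinal.{u}} (hγ : γ ≤ h x) : ∃ y ≤ x, h y = γ := by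
  rcases hγ.lt_or_eq with h' | rfl
  · obtain ⟨y, h1, h2⟩ := hh.exists_lt x γ h'
    exact ⟨y, h1.le, h2⟩
  · exact ⟨x, le_rfl, rfl⟩

/-- The order isomorphism between the predecessors of a node and its height. -/
theorem nonempty_orderIso (x : X) : Nonempty (Iio x ≃o Iio (h x)) := by
  let f : Iio x → Iio (h x) := fun y => ⟨h y, hh.lt _ _ y.2⟩
  have hf : Function.Bijective f := by
    refine ⟨fun y z hyz => Subtype.ext (hh.eq_of_lt y.2 z.2 (congrArg Subtype.val hyz)), ?_⟩
    rintro ⟨γ, hγ⟩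
    obtain ⟨y, h1, h2⟩ := hh.exists_lt x γ hγ
    exact ⟨⟨y, h1⟩, Subtype.ext h2⟩
  exact ⟨⟨Equiv.ofBijective f hf, fun {y z} => ⟨fun hyz => hh.trichotomy x y z y.2 z.2 hyz,
    fun hyz => hh.le hyz⟩⟩⟩

theorem mem_level_iff {x : X} {α : Ordinal.{u}} : x ∈ level X α ↔ h x = α := by
  obtain ⟨e⟩ := hh.nonempty_orderIso x
  constructor
  · rintro ⟨e'⟩
    have := (e.symm.trans e').ordinalType_congr
    change Ordinal.type _ = Ordinal.type _ at this
    rw [Ordinal.type_lt_Iio, Ordinal.type_lt_Iio] at this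
    exact Ordinal.lift_inj.1 this
  · rintro rfl
    exact ⟨e⟩

theorem isChain_Iio (x : X) : IsChain (· ≤ ·) (Iio x) := by
  intro y hy z hz _
  rcases le_total (h y) (h z) with h' | h'
  · exact Or.inl (hh.trichotomy x y z hy hz h')
  · exact Or.inr (hh.trichotomy x z y hz hy h')

theorem isWF (s : Set X) : s.IsWF := by
  refine Set.wellFoundedOn_iff.2 ?_
  refine Subrelation.wf (r := InvImage (· < ·) h) ?_ (InvImage.wf h Ordinal.lt_wf)
  intro a b hab
  exact hh.lt _ _ hab.1

end IsRank

theorem IsRank.isKTree {κ : Cardinal.{u}} {X : Type (u + 1)} [PartialOrder X] {h : X → Ordinal.{u}}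
    (hh : IsRank h) (hlt : ∀ x, h x < κ.ord) (hne : ∀ α < κ.ord, ∃ x, h x = α)
    (hsmall : ∀ α < κ.ord, #{x | h x = α} < lift.{u + 1} κ) : IsKTree κ X := by
  have hlev : ∀ α, level X α = {x | h x = α} := fun α => Set.ext fun x => hh.mem_level_iff
  refine ⟨hh.isChain_Iio, fun x => hh.isWF _, fun α hα => ?_, fun α hα => ?_, ?_⟩
  · rw [hlev]
    exact hne α hα
  · rw [hlev, lift_id'.{u, u + 1}]
    exact hsmall α hα
  · rw [hlev]
    exact eq_empty_of_forall_notMem fun x hx => (hlt x).ne hx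

/-! ### Binary sequences -/

theorem BinSeq.le_iff {s t : BinSeq.{u}} :
    s ≤ t ↔ s.len ≤ t.len ∧ ∀ i < s.len, t.bit i = s.bit i := by
  conv_lhs => rw [← res_bit s, ← res_bit t]
  exact res_le_res

theorem BinSeq.ext_bit {s t : BinSeq.{u}} (h : s.len = t.len)
    (h' : ∀ i < s.len, s.bit i = t.bit i) : s = t := by
  rw [← res_bit s, ← res_bit t, ← h]
  exact res_eq_res.2 h'

theorem BinSeq.lt_iff {s t : BinSeq.{u}} :
    s < t ↔ s.len < t.len ∧ ∀ i < s.len, t.bit i = s.bit i := by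
  rw [lt_iff_le_and_ne, BinSeq.le_iff]
  constructor
  · rintro ⟨⟨h1, h2⟩, h3⟩
    exact ⟨h1.lt_of_ne fun h => h3 (BinSeq.ext_bit h fun i hi => (h2 i hi).symm), h2⟩
  · rintro ⟨h1, h2⟩
    exact ⟨⟨h1.le, h2⟩, fun h => h1.ne (congrArg BinSeq.len h)⟩

theorem BinSeq.le_of_le_of_le {s t r : BinSeq.{u}} (hs : s ≤ r) (ht : t ≤ r)
    (h : s.len ≤ t.len) : s ≤ t :=
  BinSeq.le_iff.2 ⟨h, fun i hi => ((BinSeq.le_iff.1 ht).2 i (hi.trans_le h)).symm.trans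
    ((BinSeq.le_iff.1 hs).2 i hi)⟩

/-! ### The trees and their products -/

namespace TreeData
variable (P : TreeData.{u})

/-- The tree determined by `η`. -/
def tree (η : Ordinal.{u} → Bool) : Set BinSeq.{u} :=
  {s | s.len < (Order.succ P.lam).ord ∧ P.Good s.len η s.bit}

variable {P}

theorem res_mem_tree {η t : Ordinal.{u} → Bool} {γ : Ordinal.{u}} :
    res γ t ∈ P.tree η ↔ γ < (Order.succ P.lam).ord ∧ P.Good γ η t :=
  and_congr_right fun _ => P.good_congr_right fun _ hi => bit_res hi

theorem mem_tree_of_le {η : Ordinal.{u} → Bool} {s t : BinSeq.{u}} (ht : t ∈ P.tree η)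
    (h : s ≤ t) : s ∈ P.tree η := by
  obtain ⟨h1, h2⟩ := BinSeq.le_iff.1 h
  exact ⟨h1.trans_lt ht.1, (P.good_congr_right h2).1 (ht.2.mono h1)⟩

theorem isRank_tree (η : Ordinal.{u} → Bool) :
    IsRank (fun x : P.tree η => x.1.len) := by
  refine ⟨fun x y hxy => (BinSeq.lt_iff.1 hxy).1, fun x γ hγ => ?_, fun x y z hy hz h =>
    BinSeq.le_of_le_of_le (r := x.1) hy.le hz.le h⟩
  refine ⟨⟨res γ x.1.bit, res_mem_tree.2 ⟨hγ.trans x.2.1, x.2.2.mono hγ.le⟩⟩, ?_, rfl⟩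
  exact BinSeq.lt_iff.2 ⟨hγ, fun i hi => (bit_res hi).symm⟩

namespace Valid
variable (hP : P.Valid)
include hP

theorem exists_good {γ : Ordinal.{u}} (hγ : γ < (Order.succ P.lam).ord) (η : Ordinal.{u} → Bool) :
    ∃ t, P.Good γ η t := by
  rcases eq_or_ne γ 0 with rfl | h
  · exact ⟨fun _ => false, hP.good_zero _ _⟩
  · obtain ⟨t, ht, -⟩ := hP.exists_good_extension hγ (pos_iff_ne_zero.2 h)
      (hP.good_zero η fun _ => false)
    exact ⟨t, ht⟩

open Classical in
theorem good_update {γ : Ordinal.{u}} (hγ : γ < (Order.succ P.lam).ord)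
    {η t : Ordinal.{u} → Bool} (ht : P.Good γ η t) (b : Bool) :
    P.Good (γ + 1) η (Function.update t γ b) :=
  hP.good_add_one hγ ((P.good_congr_right fun _ hi => Function.update_of_ne hi.ne _ _).2 ht)

theorem mk_tree_level_lt (η : Ordinal.{u} → Bool) {α : Ordinal.{u}}
    (hα : α < (Order.succ P.lam).ord) :
    #{t ∈ P.tree η | t.len = α} < lift.{u + 1} (Order.succ P.lam) := by
  refine (mk_le_mk_of_subset (t := lev (P.Good α) α η) ?_).trans_lt
    ((hP.mk_lev_le hα η).trans_lt (lift_lt.2 (Order.lt_succ _)))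
  rintro t ⟨ht, rfl⟩
  exact ⟨t.bit, ht.2, (res_bit t).symm⟩

theorem isStreamlinedBinary (η : Ordinal.{u} → Bool) :
    IsStreamlinedBinary (Order.succ P.lam) (P.tree η) := by
  refine ⟨fun t ht => ht.1, fun t ht s hs => mem_tree_of_le ht hs, fun α hα => ?_,
    fun α hα => hP.mk_tree_level_lt η hα⟩
  obtain ⟨t, ht⟩ := hP.exists_good hα η
  exact ⟨res α t, res_mem_tree.2 ⟨hα, ht⟩, rfl⟩

theorem isKTree_tree (η : Ordinal.{u} → Bool) : IsKTree (Order.succ P.lam) (P.tree η) := by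
  refine (isRank_tree η).isKTree (fun x => x.2.1) (fun α hα => ?_) fun α hα => ?_
  · obtain ⟨t, ht⟩ := hP.exists_good hα η
    exact ⟨⟨res α t, res_mem_tree.2 ⟨hα, ht⟩⟩, rfl⟩
  · refine lt_of_le_of_lt ?_ (hP.mk_tree_level_lt η hα)
    exact mk_le_of_injective (f := fun x : {x : P.tree η | x.1.len = α} =>
      (⟨x.1.1, x.1.2, x.2⟩ : {t ∈ P.tree η | t.len = α}))
      fun x y h => Subtype.ext (Subtype.ext (Subtype.mk.inj h))

theorem isNormal_tree (η : Ordinal.{u} → Bool) :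
    FullTrees.IsNormal (Order.succ P.lam) (P.tree η) := by
  intro α hα β hβ x hx
  rw [(isRank_tree η).mem_level_iff] at hx
  subst hx
  obtain ⟨t, ht, ht'⟩ := hP.exists_good_extension hα hβ x.2.2
  refine ⟨⟨res α t, res_mem_tree.2 ⟨hα, ht⟩⟩, (isRank_tree η).mem_level_iff.2 rfl, ?_⟩
  exact BinSeq.lt_iff.2 ⟨hβ, fun i hi => (bit_res (hi.trans hβ)).trans (ht' i hi)⟩

theorem isSplitting_tree (η : Ordinal.{u} → Bool) : IsSplitting (P.tree η) := by
  classical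
  intro x
  have hx := x.2.1
  have key : ∀ b, (⟨res (x.1.len + 1) (Function.update x.1.bit x.1.len b), res_mem_tree.2
      ⟨hP.isSuccLimit_succ_ord.succ_lt hx, hP.good_update hx x.2.2 b⟩⟩ : P.tree η) ∈
        {y | x ⋖ y ∧ y.1.bit x.1.len = b} := by
    intro b
    refine ⟨⟨?_, fun z hz hz' => ?_⟩, ?_⟩
    · refine BinSeq.lt_iff.2 ⟨lt_add_one _, fun i hi => ?_⟩
      exact (bit_res (hi.trans (lt_add_one _))).trans (Function.update_of_ne hi.ne _ _)
    · exact ((BinSeq.lt_iff.1 hz).1.not_ge (Order.lt_add_one_iff.1 (BinSeq.lt_iff.1 hz').1))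
    · exact (bit_res (lt_add_one _)).trans (Function.update_self _ _ _)
  refine ⟨_, _, fun h => ?_, (key true).1, (key false).1⟩
  have h1 := (key true).2
  rw [h, (key false).2] at h1
  exact Bool.false_ne_true h1

/-- The branch glues to a sequence `t` whose restrictions below `α` are all nodes; unless `t` is
removed at `α`, its restriction to `α` is an upper bound. -/
theorem exists_kill_of_isVanishing {η : Ordinal.{u} → Bool} {α : Ordinal.{u}}
    (hα : α < (Order.succ P.lam).ord) (hlim : Order.IsSuccLimit α) {B : Set (P.tree η)}
    (hB : IsBranch α B) (hB' : IsVanishing B) :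
    ∃ t, P.Kill P.Good α η t ∧ (∀ γ < α, P.Good γ η t) ∧
      ∀ x, x ∈ B ↔ x.1.len < α ∧ x.1 = res x.1.len t := by
  obtain ⟨h1, h2, h3⟩ := hB
  simp only [(isRank_tree η).mem_level_iff] at h2 h3
  have : ∀ γ, ∃ x : BinSeq.{u}, γ < α → ∃ hx : x ∈ P.tree η, ⟨x, hx⟩ ∈ B ∧ x.len = γ := fun γ => by
    by_cases hγ : γ < α
    · obtain ⟨x, hx, hx'⟩ := h3 γ hγ
      exact ⟨x.1, fun _ => ⟨x.2, hx, hx'⟩⟩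
    · exact ⟨res 0 fun _ => false, fun h => absurd h hγ⟩
  choose c hc using this
  -- Bit `i` is read from the branch node of length `i + 1`, the shortest one that has it.
  let t : Ordinal.{u} → Bool := fun i => (c (i + 1)).bit i
  have hmem : ∀ x ∈ B, x.1.len < α ∧ x.1 = res x.1.len t := by
    intro x hx
    obtain ⟨β, hβ, hxβ⟩ := h2 x hx
    have hxα : x.1.len < α := hxβ ▸ hβ
    refine ⟨hxα, BinSeq.ext_bit rfl fun i hi => ?_⟩
    rw [bit_res hi]
    obtain ⟨hy, hyB, hyl⟩ := hc (i + 1) (hlim.succ_lt (hi.trans hxα))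
    have hiy : i < (c (i + 1)).len := by rw [hyl]; exact lt_add_one i
    rcases h1.total hx hyB with h | h
    · exact ((BinSeq.le_iff.1 h).2 i hi).symm
    · exact (BinSeq.le_iff.1 h).2 i hiy
  have hres : ∀ γ < α, ∃ h : res γ t ∈ P.tree η, ⟨res γ t, h⟩ ∈ B := by
    intro γ hγ
    obtain ⟨hy, hyB, hyl⟩ := hc γ hγ
    have := (hmem _ hyB).2
    simp only [hyl] at this
    rw [← this]
    exact ⟨hy, hyB⟩
  have hgood : ∀ γ < α, P.Good γ η t := fun γ hγ => (res_mem_tree.1 (hres γ hγ).1).2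
  refine ⟨t, ?_, hgood, fun x => ⟨hmem x, fun ⟨h4, h5⟩ => ?_⟩⟩
  · by_contra hk
    refine hB' ⟨⟨res α t, res_mem_tree.2 ⟨hα, (hP.good_iff hα).2 ⟨hgood, hk⟩⟩⟩, fun x hx => ?_⟩
    obtain ⟨h4, h5⟩ := hmem x hx
    change x.1 ≤ res α t
    rw [h5]
    exact res_le_res.2 ⟨h4.le, fun _ _ => rfl⟩
  · obtain ⟨h6, h7⟩ := hres _ h4
    convert! h7

theorem isFull_tree (η : Ordinal.{u} → Bool) : IsFull (Order.succ P.lam) (P.tree η) := by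
  rintro α hα hlim B ⟨hB, hB'⟩ B' ⟨hB₁, hB₁'⟩
  obtain ⟨t, h1, h2, h3⟩ := hP.exists_kill_of_isVanishing hα hlim hB hB'
  obtain ⟨t', h1', h2', h3'⟩ := hP.exists_kill_of_isVanishing hα hlim hB₁ hB₁'
  ext x
  rw [h3, h3']
  refine and_congr_right fun hx => ?_
  rw [res_eq_res.2 fun i hi => hP.kill_unique hα h1 h1' h2 h2' (hi.trans hx)]

end Valid

/-! ### Products -/

section Product
variable {I : Type (u + 1)} [hI : Nonempty I] (η : I → Ordinal.{u} → Bool)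

/-- The product of the trees given by `η`. -/
abbrev ProdTree := FullTrees.Prod (Order.succ P.lam) fun i => P.tree (η i)

variable {η}

/-- The height of a node of the product. -/
noncomputable def prodLen (x : ProdTree (P := P) η) : Ordinal.{u} :=
  (x.1 (Classical.arbitrary I)).1.len

theorem len_eq_prodLen (x : ProdTree (P := P) η) (i : I) : (x.1 i).1.len = prodLen x := by
  obtain ⟨α, -, hα⟩ := x.2
  rw [prodLen, (isRank_tree (η i)).mem_level_iff.1 (hα i),
    (isRank_tree _).mem_level_iff.1 (hα (Classical.arbitrary I))]

theorem prodLen_lt (x : ProdTree (P := P) η) : prodLen x < (Order.succ P.lam).ord :=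
  (x.1 (Classical.arbitrary I)).2.1

theorem good_prod (x : ProdTree (P := P) η) (i : I) : P.Good (prodLen x) (η i) (x.1 i).1.bit := by
  rw [← len_eq_prodLen x i]
  exact (x.1 i).2.2

/-- The node of the product with coordinates `res γ (y i)`. -/
def prodNode {γ : Ordinal.{u}} (hγ : γ < (Order.succ P.lam).ord) (y : I → Ordinal.{u} → Bool)
    (hy : ∀ i, P.Good γ (η i) (y i)) : ProdTree (P := P) η :=
  ⟨fun i => ⟨res γ (y i), res_mem_tree.2 ⟨hγ, hy i⟩⟩, γ, hγ, fun i =>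
    (isRank_tree (η i)).mem_level_iff.2 rfl⟩

theorem prod_lt_iff {x y : ProdTree (P := P) η} :
    x < y ↔ prodLen x < prodLen y ∧ ∀ i, ∀ k < prodLen x, (y.1 i).1.bit k = (x.1 i).1.bit k := by
  rw [Prod.lt_iff]
  constructor
  · intro h
    refine ⟨(BinSeq.lt_iff.1 (h _)).1, fun i k hk => (BinSeq.lt_iff.1 (h i)).2 k ?_⟩
    rwa [len_eq_prodLen]
  · rintro ⟨h1, h2⟩ i
    refine BinSeq.lt_iff.2 ⟨?_, fun k hk => h2 i k ?_⟩
    · rwa [len_eq_prodLen, len_eq_prodLen]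
    · rwa [len_eq_prodLen] at hk

theorem prod_ext {x y : ProdTree (P := P) η} (h : prodLen x = prodLen y)
    (h' : ∀ i, ∀ k < prodLen x, (x.1 i).1.bit k = (y.1 i).1.bit k) : x = y := by
  refine Subtype.ext (funext fun i => Subtype.ext (BinSeq.ext_bit ?_ fun k hk => h' i k ?_))
  · rw [len_eq_prodLen, len_eq_prodLen, h]
  · rwa [len_eq_prodLen] at hk

theorem isRank_prod : IsRank (prodLen (P := P) (η := η)) := by
  refine ⟨fun x y h => (prod_lt_iff.1 h).1, fun x γ hγ => ?_, fun x y z hy hz h => ?_⟩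
  · refine ⟨prodNode (hγ.trans (prodLen_lt x)) (fun i => (x.1 i).1.bit)
      (fun i => (good_prod x i).mono hγ.le), prod_lt_iff.2 ⟨hγ, fun i k hk => ?_⟩, rfl⟩
    exact (bit_res hk).symm
  · obtain ⟨-, hy⟩ := prod_lt_iff.1 hy
    obtain ⟨-, hz⟩ := prod_lt_iff.1 hz
    rcases h.lt_or_eq with h | h
    · exact (prod_lt_iff.2 ⟨h, fun i k hk => (hz i k (hk.trans h)).symm.trans (hy i k hk)⟩).le
    · exact (prod_ext h fun i k hk => (hy i k hk).symm.trans (hz i k (h ▸ hk))).le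

theorem le_prodNode {x : ProdTree (P := P) η} {γ : Ordinal.{u}}
    (hγ : γ < (Order.succ P.lam).ord) {y : I → Ordinal.{u} → Bool}
    (hy : ∀ i, P.Good γ (η i) (y i)) (h : prodLen x ≤ γ)
    (h' : ∀ i, ∀ k < prodLen x, y i k = (x.1 i).1.bit k) : x ≤ prodNode hγ y hy := by
  rcases h.lt_or_eq with h | h
  · exact (prod_lt_iff.2 ⟨h, fun i k hk => (bit_res (hk.trans h)).trans (h' i k hk)⟩).le
  · refine (prod_ext (y := prodNode hγ y hy) h fun i k hk => (h' i k hk).symm.trans ?_).le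
    exact (bit_res (t := y i) (h ▸ hk)).symm

theorem Valid.mk_prod_lt (hP : P.Valid) (hI : #I < lift.{u + 1} P.lam) {α : Ordinal.{u}}
    (hα : α < (Order.succ P.lam).ord) :
    #{x : ProdTree (P := P) η | prodLen x < α} < lift.{u + 1} (Order.succ P.lam) := by
  have h1 : #{x : ProdTree (P := P) η | prodLen x < α} ≤
      #(Σ γ : Iio α, ∀ i, lev (P.Good γ.1) γ.1 (η i)) := by
    refine mk_le_of_injective (f := fun x => ⟨⟨prodLen x.1, x.2⟩, fun i =>
      ⟨res (prodLen x.1) (x.1.1 i).1.bit, mem_lev (good_prod x.1 i)⟩⟩) fun x y h => ?_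
    have h2 : prodLen x.1 = prodLen y.1 := congrArg (fun z => z.1.1) h
    refine Subtype.ext (prod_ext h2 fun i k hk => ?_)
    have h3 : res (prodLen x.1) (x.1.1 i).1.bit = res (prodLen y.1) (y.1.1 i).1.bit :=
      congrArg (fun z => (z.2 i).1) h
    rw [← h2] at h3
    exact res_eq_res.1 h3 k hk
  refine h1.trans_lt ?_
  have hinf : ℵ₀ ≤ lift.{u + 1} P.lam := by
    rw [aleph0_le_lift]
    exact hP.uncountable.le
  rw [mk_sigma, lift_succ, Order.lt_succ_iff]
  refine (sum_le_sum _ (fun _ : Iio α => lift.{u + 1} P.lam) fun γ : Iio α => ?_).trans ?_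
  · have := hP.mk_tuples_lt hI η ((mem_Iio.1 γ.2).trans hα)
    rwa [lift_succ, Order.lt_succ_iff] at this
  · rw [sum_const', mk_Iio_ordinal]
    refine (mul_le_mul' (lift_le.2 ?_) (le_refl _)).trans (mul_eq_self hinf).le
    exact Order.lt_succ_iff.1 (lt_ord.1 hα)

theorem Sealing.exists_sealed_level_prod (hS : P.Sealing) (hI : #I < lift.{u + 1} P.lam)
    (hη : ∀ i i', i ≠ i' → ∃ γ < (Order.succ P.lam).ord, η i γ ≠ η i' γ)
    {A : Set (ProdTree (P := P) η)} (hA : ∀ x, ∃ a ∈ A, x ≤ a) :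
    ∃ α < (Order.succ P.lam).ord, ∀ x : ProdTree (P := P) η, prodLen x = α → ∃ a ∈ A, a < x := by
  obtain ⟨α, hα, h⟩ := hS.exists_sealed_level hI hη
    (A := {a | ∃ x ∈ A, ∀ i, a i = (x.1 i).1})
    (by
      rintro a ⟨x, -, hx⟩ i i'
      rw [hx, hx, len_eq_prodLen, len_eq_prodLen])
    (by
      intro γ hγ y hy
      obtain ⟨a, haA, ha⟩ := hA (prodNode hγ y hy)
      refine ⟨prodLen a, prodLen_lt a, isRank_prod.le ha, fun i => (a.1 i).1.bit, good_prod a,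
        fun i k hk => ?_, a, haA, fun i => ?_⟩
      · rcases ha.lt_or_eq with h | rfl
        · exact ((prod_lt_iff.1 h).2 i k hk).trans (bit_res hk)
        · exact bit_res hk
      · have := res_bit (a.1 i).1
        rwa [len_eq_prodLen] at this)
  refine ⟨α, hα, fun x hx => ?_⟩
  subst hx
  obtain ⟨γ, hγ, a, haA, ha⟩ := h (fun i => (x.1 i).1.bit) (good_prod x)
  have hγa : prodLen a = γ := by
    rw [← len_eq_prodLen a (Classical.arbitrary I), ← ha, res_len]
  refine ⟨a, haA, prod_lt_iff.2 ⟨hγa ▸ hγ, fun i k hk => ?_⟩⟩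
  rw [← ha, bit_res (hγa ▸ hk)]

/-- For a cofinal branch `B`, splitting makes the complement dense, and a sealed level puts a node
outside `B` below a node of `B`, which is absurd. For an antichain `A`, the nodes above a member of
`A` or incompatible with all of `A` are dense; sealing them confines `A` to the levels below `α`,
which contain at most `λ` nodes. -/
theorem Sealing.isSouslin_prodTree (hS : P.Sealing) (hI : #I < lift.{u + 1} P.lam)
    (hη : ∀ i i', i ≠ i' → ∃ γ < (Order.succ P.lam).ord, η i γ ≠ η i' γ) :
    IsSouslin (Order.succ P.lam) (ProdTree (P := P) η) := by
  classical
  have hP := hS.toValid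
  have hrank := isRank_prod (P := P) (η := η)
  have hsucc : ∀ γ < (Order.succ P.lam).ord, γ + 1 < (Order.succ P.lam).ord :=
    fun γ hγ => hP.isSuccLimit_succ_ord.succ_lt hγ
  refine ⟨hrank.isKTree prodLen_lt (fun α hα => ?_) fun α hα => ?_, ?_, ?_⟩
  · choose t ht using fun i => hP.exists_good hα (η i)
    exact ⟨prodNode hα t ht, rfl⟩
  · refine (mk_le_mk_of_subset fun x (hx : prodLen x = α) => ?_).trans_lt
      (hP.mk_prod_lt hI (hsucc α hα))
    exact hx.trans_lt (lt_add_one α)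
  · rintro ⟨B, h1, h2, h3⟩
    simp only [hrank.mem_level_iff] at h2 h3
    obtain ⟨α, hα, h⟩ := hS.exists_sealed_level_prod hI hη (A := Bᶜ) (by
      intro x
      by_cases hx : x ∈ B
      swap
      · exact ⟨x, hx, le_rfl⟩
      let e : Bool → ProdTree (P := P) η := fun b =>
        prodNode (hsucc _ (prodLen_lt x)) (fun i => Function.update (x.1 i).1.bit (prodLen x) b)
          fun i => hP.good_update (prodLen_lt x) (good_prod x i) b
      have hxe : ∀ b, x ≤ e b := fun b => le_prodNode _ _ (lt_add_one _).le fun i k hk =>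
        Function.update_of_ne hk.ne _ _
      have hbit : ∀ b, ((e b).1 (Classical.arbitrary I)).1.bit (prodLen x) = b := fun b =>
        (bit_res (lt_add_one _)).trans (Function.update_self _ _ _)
      have hne : e true ≠ e false := fun h => by
        have := hbit true
        rw [h, hbit] at this
        exact Bool.false_ne_true this
      by_contra! hcon
      have ht : e true ∈ B := by
        by_contra h
        exact hcon _ h (hxe true)
      have hf : e false ∈ B := by
        by_contra h
        exact hcon _ h (hxe false)
      rcases h1.total ht hf with h | h
      · exact (hrank.lt _ _ (h.lt_of_ne hne)).ne rfl
      · exact (hrank.lt _ _ (h.lt_of_ne hne.symm)).ne rfl)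
    obtain ⟨b, hb, hbα⟩ := h3 α hα
    obtain ⟨a, ha, hab⟩ := h b hbα
    obtain ⟨a', ha', haa'⟩ := h3 (prodLen a) (prodLen_lt a)
    have hlt : prodLen a' < prodLen b := haa'.trans_lt (hrank.lt _ _ hab)
    have ha'b : a' < b := by
      rcases h1.total ha' hb with h | h
      · exact h.lt_of_ne fun h => hlt.ne (h ▸ rfl)
      · exact absurd (hrank.le h) hlt.not_ge
    exact ha (hrank.eq_of_lt hab ha'b haa'.symm ▸ ha')
  · rintro ⟨A, h1, h2⟩
    obtain ⟨α, hα, h⟩ := hS.exists_sealed_level_prod hI hη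
      (A := {x | (∃ a ∈ A, a ≤ x) ∨ ∀ a ∈ A, ∀ z, a ≤ z → ¬ x ≤ z}) (by
        intro x
        by_cases hx : ∃ a ∈ A, ∃ z, a ≤ z ∧ x ≤ z
        · obtain ⟨a, ha, z, haz, hxz⟩ := hx
          exact ⟨z, Or.inl ⟨a, ha, haz⟩, hxz⟩
        · push Not at hx
          exact ⟨x, Or.inr hx, le_rfl⟩)
    have hsub : A ⊆ {x | prodLen x < α} := by
      intro a ha
      by_contra hlt
      obtain ⟨b, hba, hb⟩ := hrank.exists_le (not_lt.1 hlt)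
      obtain ⟨c, hc | hc, hcb⟩ := h b hb
      · obtain ⟨a', ha', ha'c⟩ := hc
        have hlt' := (ha'c.trans_lt hcb).trans_le hba
        exact h1 ha' ha hlt'.ne hlt'.le
      · exact hc a ha a le_rfl (hcb.le.trans hba)
    rw [lift_id'.{u, u + 1}] at h2
    exact ((mk_le_mk_of_subset hsub).trans_lt (hP.mk_prod_lt hI hα)).ne h2

theorem Sealing.isSouslin_prod (hS : P.Sealing) {T : I → Set BinSeq.{u}}
    (hT : ∀ i, T i = P.tree (η i)) (hI : #I < lift.{u + 1} P.lam)
    (hη : ∀ i i', i ≠ i' → ∃ γ < (Order.succ P.lam).ord, η i γ ≠ η i' γ) :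
    IsSouslin (Order.succ P.lam) (FullTrees.Prod (Order.succ P.lam) fun i => T i) := by
  obtain rfl : T = fun i => P.tree (η i) := funext hT
  exact hS.isSouslin_prodTree hI hη

end Product

/-- Since the parameters differ, the dense set of pairs of distinct nodes of equal length can be
sealed at some level. A common tree would have a node `t` there, and the pair `(t, t)` extends no
such pair. -/
theorem Sealing.tree_ne (hS : P.Sealing) {η η' : Ordinal.{u} → Bool}
    (h : ∃ γ < (Order.succ P.lam).ord, η γ ≠ η' γ) : P.tree η ≠ P.tree η' := by
  classical
  intro heq
  have hP := hS.toValid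
  obtain ⟨γ₀, hγ₀, hne⟩ := h
  let e : ULift.{u + 1} Bool → Ordinal.{u} → Bool := fun b => if b.down then η else η'
  obtain ⟨α, hα, h⟩ := hS.exists_sealed_level (I := ULift.{u + 1} Bool) (η := e)
    (A := {a | (∃ γ, ∀ i, (a i).len = γ) ∧ a ⟨true⟩ ≠ a ⟨false⟩})
    (by
      rw [mk_uLift, mk_bool, lift_two]
      exact (natCast_lt_aleph0 (n := 2)).trans (aleph0_lt_lift.2 hP.uncountable))
    (by
      rintro ⟨_ | _⟩ ⟨_ | _⟩ hii
      · exact absurd rfl hii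
      · exact ⟨γ₀, hγ₀, hne.symm⟩
      · exact ⟨γ₀, hγ₀, hne⟩
      · exact absurd rfl hii)
    (by
      rintro a ⟨⟨γ, hγ⟩, -⟩ i i'
      rw [hγ, hγ])
    (by
      intro γ hγ y hy
      refine ⟨γ + 1, hP.isSuccLimit_succ_ord.succ_lt hγ, (lt_add_one γ).le,
        fun i => Function.update (y i) γ i.down, fun i => hP.good_update hγ (hy i) _,
        fun i k hk => Function.update_of_ne hk.ne _ _, ⟨_, fun i => rfl⟩, fun h => ?_⟩
      have := res_eq_res.1 h γ (lt_add_one γ)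
      simp at this)
  obtain ⟨t, ht⟩ := hP.exists_good hα η
  have ht' : P.Good α η' t := (res_mem_tree.1 (heq ▸ res_mem_tree.2 ⟨hα, ht⟩)).2
  obtain ⟨γ, -, -, h2⟩ := h (fun _ => t) (by
    rintro ⟨_ | _⟩
    · exact ht'
    · exact ht)
  exact h2 rfl

end TreeData

/-! ### Assembling the parameters of the construction -/

namespace TreeData

/-- The hypotheses of the main theorem provide the guessing data for the construction. -/
theorem exists_sealing {lam : Cardinal.{u}} (hreg : lam.IsRegular) (hunc : ℵ₀ < lam)
    (hpow : Order.succ lam = 2 ^ lam) (hsquare : BaumgartnerSquare lam) (hdiamond : Diamond lam)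
    (hproxy : ProxyMinus (Order.succ lam) (InitialSegMod lam) (Order.succ lam)
      {E (Order.succ lam) lam}) :
    ∃ P : TreeData.{u}, P.lam = lam ∧ P.Sealing := by
  have hle : ∀ c < lam, lam ^ c ≤ lam := fun c hc => hdiamond.power_le hreg hunc hc
  obtain ⟨C, hC, hhit⟩ := exists_ladder_of_proxy hunc hproxy
  obtain ⟨D, F, hD, hguess⟩ := exists_guessing_ladder hreg hunc hsquare hdiamond
  let N := {s : BinSeq.{u} // s.len < (Order.succ lam).ord}
  have hpos : 0 < (Order.succ lam).ord := ord_pos.2 (Order.bot_lt_succ lam)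
  let n₀ : N := ⟨res 0 fun _ => false, hpos⟩
  have hN : #N ≤ lift.{u + 1} (2 ^ lam) := mk_binSeq_le hunc.le hpow
  have hinf : ℵ₀ ≤ lift.{u + 1} (2 ^ lam) := by
    rw [aleph0_le_lift, ← hpow]
    exact hunc.le.trans (Order.le_succ lam)
  have hV : #(Iio lam.ord → N × N × N) ≤ lift.{u + 1} (2 ^ lam) := by
    rw [← power_def, mk_Iio_ordinal, card_ord]
    have h3 : #(N × N × N) ≤ lift.{u + 1} (2 ^ lam) := by
      simp only [mk_prod, lift_id]
      exact (mul_le_mul' hN ((mul_le_mul' hN hN).trans (mul_eq_self hinf).le)).trans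
        (mul_eq_self hinf).le
    refine (power_le_power_right h3).trans ?_
    rw [← lift_power, ← power_mul, mul_eq_self hunc.le]
  have : Nonempty (Iio lam.ord → N × N × N) := ⟨fun _ => (n₀, n₀, n₀)⟩
  obtain ⟨Ω, hΩ⟩ := exists_diamond_succ hunc.le hpow (hle _ hunc) hV
  let P : TreeData.{u} :=
    ⟨lam, C, D, F, fun β γ j => ((Ω β γ j).1.1, (Ω β γ j).2.1.1, (Ω β γ j).2.2.1)⟩
  refine ⟨P, rfl, ⟨⟨hunc, hle, hC, hD, hguess⟩, hpow, fun G hG d hd => ?_, hhit⟩⟩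
  classical
  obtain ⟨β, hβ, h0, h1, h2⟩ := hΩ (fun γ j => if h : γ < (Order.succ lam).ord then
    (⟨_, (hG γ h j).1⟩, ⟨_, (hG γ h j).2.1⟩, ⟨_, (hG γ h j).2.2⟩) else (n₀, n₀, n₀)) d hd
  refine ⟨β, hβ, h0, h1, fun γ hγ => funext fun j => ?_⟩
  have h3 := congrFun (h2 γ hγ) j
  simp only [dif_pos (hγ.trans hβ)] at h3
  change _ = ((Ω β γ j).1.1, (Ω β γ j).2.1.1, (Ω β γ j).2.2.1)
  rw [← h3]

/-- The extension by zeros of a function on an initial segment of the ordinals. -/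
noncomputable def zeroExtend (o : Ordinal.{u}) (f : Iio o → Bool) : Ordinal.{u} → Bool :=
  (BinSeq.mk o f).bit

theorem exists_zeroExtend_ne {o : Ordinal.{u}} {f g : Iio o → Bool} (h : f ≠ g) :
    ∃ γ < o, zeroExtend o f γ ≠ zeroExtend o g γ := by
  obtain ⟨⟨γ, hγ⟩, h⟩ := Function.ne_iff.1 h
  exact ⟨γ, hγ, by simpa [zeroExtend, BinSeq.bit, mem_Iio.1 hγ] using h⟩

end TreeData
end FullTrees

/-! ### The main theorem -/

open FullTrees
theorem mainTheorem4 (lam κ : Cardinal.{u}) (hreg : lam.IsRegular) (hunc : ℵ₀ < lam)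
    (hsucc : κ = Order.succ lam) (hpow : κ = 2 ^ lam)
    (hsquare : BaumgartnerSquare lam) (hdiamond : Diamond lam)
    (hproxy : ProxyMinus κ (InitialSegMod lam) κ {E κ lam}) :
    ∃ 𝒯 : Set (Set BinSeq.{u}),
      #𝒯 = lift.{u + 1} (2 ^ κ) ∧
      (∀ T ∈ 𝒯, IsStreamlinedBinary κ T ∧ IsKTree κ T ∧
        FullTrees.IsNormal κ T ∧ IsSplitting T ∧ IsFull κ T) ∧
      ∀ 𝒯' ⊆ 𝒯, 𝒯'.Nonempty → #𝒯' < lift.{u + 1} lam →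
        IsSouslin κ (FullTrees.Prod κ fun T : 𝒯' => (T : Set BinSeq.{u})) := by
  subst hsucc
  obtain ⟨P, rfl, hP⟩ := TreeData.exists_sealing hreg hunc hpow hsquare hdiamond hproxy
  let T : (Iio (Order.succ P.lam).ord → Bool) → Set BinSeq.{u} := fun f =>
    P.tree (TreeData.zeroExtend _ f)
  have hT : Function.Injective T := fun f g h => by
    by_contra hne
    exact hP.tree_ne (TreeData.exists_zeroExtend_ne hne) h
  refine ⟨range T, ?_, ?_, fun 𝒯' hsub hne hcard => ?_⟩
  · rw [mk_range_eq T hT]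
    simp [mk_Iio_ordinal]
  · rintro _ ⟨f, rfl⟩
    exact ⟨hP.isStreamlinedBinary _, hP.isKTree_tree _, hP.isNormal_tree _, hP.isSplitting_tree _,
      hP.isFull_tree _⟩
  · have : Nonempty 𝒯' := hne.to_subtype
    choose f hf using fun X : 𝒯' => hsub X.2
    refine hP.isSouslin_prod (η := fun X => TreeData.zeroExtend _ (f X)) (fun X => (hf X).symm)
      hcard fun X Y hXY => TreeData.exists_zeroExtend_ne fun h => hXY (Subtype.ext ?_)
    rw [← hf X, ← hf Y, h]
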